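/- Let $\mathbb D=\{z\in\mathbb C:|z|<1\}$. A complex-valued harmonic function $f$ on $\mathbb D$ can be written as $f=h+\overline g$ with $h,g$ analytic on $\mathbb D$ (uniquely up to additive constants). It is called sense-preserving in $\mathbb D$ if, at every $z_0\in\mathbb D$, $h'$ does not vanish identically near $z_0$ and the function $\omega$ given by $g'=\omega h'$ (removable singularities being removed) is analytic at $z_0$ with $|\omega(z_0)|<1$. Let $\mathcal T_H^O$ be the class of all sense-preserving harmonic functions $f=h+\overline g$ on $\mathbb D$ such that, for $z\in\mathbb D$, $f(z)$ is real if and only if $z$ is real, and such that $f(0)=0$, $|h'(0)|=1$, $g'(0)=0$, and $f(r)>0$ for $0<r<1$. Theorem. Every function $f\in\mathcal T_H^O$ is univalent (that is, injective) in each of the following domains: (a) the disk $\{z\in\mathbb C: |z|<\sqrt6-\sqrt5\}$; (b) $\left\{z\in\mathbb D:\ \left|\dfrac{2z}{1+z^2}\right|<\sqrt2-1\right\}$. -/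

import Mathlib

namespace TypicallyReal

open Metric Filter Topology ComplexConjugate

/-- `f = h + conj g` on the open unit disk, with `f` (complex-valued) harmonic there and `h`, `g`
analytic there. Every harmonic function on the disk is of this form, and conversely
(`harmonicOnNhd_iff_exists_decomposition` below). The functions are total functions on `ℂ`, but
only their restrictions to the disk matter. -/
structure IsDecomposition (f h g : ℂ → ℂ) : Prop where
  harmonic : InnerProductSpace.HarmonicOnNhd f (ball 0 1)
  analytic_h : AnalyticOnNhd ℂ h (ball 0 1)
  analytic_g : AnalyticOnNhd ℂ g (ball 0 1)
  eq_add_conj : ∀ z ∈ ball (0 : ℂ) 1, f z = h z + conj (g z)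

/-- `h + conj g` is sense-preserving at `z₀`: `h'` does not vanish identically near `z₀`, and the
dilatation `ω = g' / h'` (removable singularities being removed) is analytic at `z₀` with
`|ω z₀| < 1`. -/
def SensePreservingAt (h g : ℂ → ℂ) (z₀ : ℂ) : Prop :=
  (¬ ∀ᶠ z in 𝓝 z₀, deriv h z = 0) ∧
    ∃ ω : ℂ → ℂ, AnalyticAt ℂ ω z₀ ∧ (∀ᶠ z in 𝓝 z₀, deriv g z = ω z * deriv h z) ∧ ‖ω z₀‖ < 1

/-- The harmonic function `f = h + conj g` belongs to the class of sense-preserving typically real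
harmonic functions with `|h'(0)| = 1`. -/
structure IsTypicallyRealHarmonic (f h g : ℂ → ℂ) : Prop extends IsDecomposition f h g where
  sensePreserving : ∀ z ∈ ball (0 : ℂ) 1, SensePreservingAt h g z
  real_iff : ∀ z ∈ ball (0 : ℂ) 1, (f z).im = 0 ↔ z.im = 0
  map_zero : f 0 = 0
  norm_deriv_zero : ‖deriv h 0‖ = 1
  pos : ∀ r : ℝ, 0 < r → r < 1 → 0 < (f r).re

/-- The class `𝒯_H`. -/
def classTH : Set (ℂ → ℂ) :=
  {f | ∃ h g : ℂ → ℂ, IsTypicallyRealHarmonic f h g}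

/-- The subclass `𝒯_H^O` of `𝒯_H`, given by `g'(0) = 0`. -/
def classTHO : Set (ℂ → ℂ) :=
  {f | ∃ h g : ℂ → ℂ, IsTypicallyRealHarmonic f h g ∧ deriv g 0 = 0}

theorem harmonicOnNhd_of_eq_add_conj {f h g : ℂ → ℂ}
    (hh : AnalyticOnNhd ℂ h (ball 0 1)) (hg : AnalyticOnNhd ℂ g (ball 0 1))
    (hf : ∀ z ∈ ball (0 : ℂ) 1, f z = h z + conj (g z)) :
    InnerProductSpace.HarmonicOnNhd f (ball 0 1) := by
  intro z hz
  have h1 : InnerProductSpace.HarmonicAt h z := (hh z hz).harmonicAt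
  have h2 : InnerProductSpace.HarmonicAt g z := (hg z hz).harmonicAt
  have h3 := h1.add (h2.comp_CLM (Complex.conjCLE : ℂ →L[ℝ] ℂ))
  refine (InnerProductSpace.harmonicAt_congr_nhds ?_).2 h3
  filter_upwards [isOpen_ball.mem_nhds hz] with w hw
  simp [hf w hw]

/-- A function is harmonic on the disk if and only if it is `h + conj g` there with `h` and `g`
analytic on the disk. -/
theorem harmonicOnNhd_iff_exists_decomposition (f : ℂ → ℂ) :
    InnerProductSpace.HarmonicOnNhd f (ball 0 1) ↔ ∃ h g : ℂ → ℂ, IsDecomposition f h g := by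
  constructor
  · intro hf
    obtain ⟨A, hA, hA'⟩ :=
      (hf.comp_CLM Complex.reCLM).exists_analyticOnNhd_ball_re_eq
    obtain ⟨B, hB, hB'⟩ :=
      (hf.comp_CLM Complex.imCLM).exists_analyticOnNhd_ball_re_eq
    refine ⟨fun z => (A z + Complex.I * B z) / 2, fun z => (A z - Complex.I * B z) / 2, hf,
      ?_, ?_, ?_⟩
    · intro z hz
      have := hA z hz
      have := hB z hz
      fun_prop (disch := norm_num)
    · intro z hz
      have := hA z hz
      have := hB z hz
      fun_prop (disch := norm_num)
    · intro z hz
      have h1 := hA' hz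
      have h2 := hB' hz
      simp at h1 h2
      apply Complex.ext <;> simp [-map_div₀, -map_sub] <;> linarith
  · rintro ⟨h, g, hd⟩
    exact hd.harmonic

end TypicallyReal

/-!
Write `f = h + conj g` and `φ = h - g`, so that `Im f = Im φ` and `φ` is an analytic typically real
function. The shear principle `eq_of_segment_subset_image` reduces the injectivity of `f` on a
domain to two properties of `φ`: it is injective there, and its image contains the horizontal
segment joining any two image points at the same height. Indeed `Re f` increases along the preimage
of such a segment, because `(h' + g') / (h' - g')` has positive real part.

On a disk `|z| < r` both properties follow (`injOn_ball`) from

* `Re φ' > 0`: then `φ` is injective, and in the upper half disk a level set of `Im φ` is a graph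
  over the real part, since `Im φ` increases along vertical chords;
* `Im (z (z φ')') > 0` wherever `Re (z φ') = 0` in the upper half disk (and the mirrored condition
  in the lower one): then `Im φ` is unimodal along the upper half of each circle `|z| = R`, so
  that the set of abscissae over which a level curve exists is an interval.

To verify these, `φ` is written as a positive superposition of the kernels `z / (1 - 2 t z + z²)`,
`-1 ≤ t ≤ 1` (`schwarz_integral_formula`); the dilation `z ↦ φ (σ z)` with `σ < 1` makes the
boundary values continuous, so that no weak limit of measures is needed. The first property is
linear in `φ`. The second becomes linear after adding a real multiple `l (z)` of `Re (z φ') = 0`: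
it is enough that for each `z` some `l` satisfies `l * Re (z k') < Im z * Im (z (z k')')` for all
kernels `k` at once. For the kernels above this holds if `|z| < √6 - √5`
(`exists_koebe_certificate`). In the coordinate `ζ = 2 z / (1 + z²)` the kernels become
`ζ / (2 (1 - t ζ))`, for which it holds if `|ζ| < √2 - 1` (`exists_cauchy_certificate`).
-/

open Complex Set Metric Filter Topology ComplexConjugate MeasureTheory

/-! ### Certificates for the two kernels -/

theorem koebe_quadratic_nonneg {p : ℝ} (hp : 4.89 < p) (w : ℝ) :
    0 ≤ w ^ 2 * (12 * p ^ 2 - 24 - 8 * p) - 4 * p * w * (p ^ 2 + 6)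
      + (2 * p ^ 4 - 24 * p ^ 2 - 32) := by
  have hα : 0 < 12 * p ^ 2 - 24 - 8 * p := by nlinarith
  have h1 : 0 ≤ p ^ 4 * (20 * p ^ 2 - 16 * p - 384) :=
    mul_nonneg (by positivity) (by nlinarith)
  have h2 : 0 ≤ 192 * p ^ 3 + 48 * p ^ 2 + 256 * p + 768 := by positivity
  have h3 := sq_nonneg ((12 * p ^ 2 - 24 - 8 * p) * w - 2 * p * (p ^ 2 + 6))
  refine nonneg_of_mul_nonneg_right ?_ hα
  have e : (12 * p ^ 2 - 24 - 8 * p) * (w ^ 2 * (12 * p ^ 2 - 24 - 8 * p)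
      - 4 * p * w * (p ^ 2 + 6) + (2 * p ^ 4 - 24 * p ^ 2 - 32))
      = ((12 * p ^ 2 - 24 - 8 * p) * w - 2 * p * (p ^ 2 + 6)) ^ 2
        + p ^ 4 * (20 * p ^ 2 - 16 * p - 384)
        + (192 * p ^ 3 + 48 * p ^ 2 + 256 * p + 768) := by ring
  rw [e]; positivity

theorem koebe_bracket_nonneg {p w s b : ℝ} (hp : 4.89 < p) (hw0 : 0 ≤ w) (hw1 : w ≤ 2)
    (hb0 : 0 ≤ b) (hb1 : b ≤ 1) (hs : s ≤ p * w) :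
    0 ≤ 2 * p ^ 4 - 24 * p ^ 2 - 32 - 24 * w ^ 2 + 12 * p ^ 2 * w ^ 2 + 2 * w ^ 4
      - 4 * s * (p ^ 2 + 6 + w ^ 2 - 4 * b) := by
  have e1 : s * (p ^ 2 + 6 + w ^ 2 - 4 * b) ≤ p * w * (p ^ 2 + 6 + w ^ 2 - 4 * b) :=
    mul_le_mul_of_nonneg_right hs (by nlinarith)
  have e0 : 0 ≤ p * w * b := by positivity
  have e2 : 0 ≤ p * w ^ 2 * (2 - w) := mul_nonneg (by positivity) (by linarith)
  have e3 : 0 ≤ w ^ 4 := by positivity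
  have e4 := koebe_quadratic_nonneg hp w
  linarith

/-- The polynomial inequality behind `koebe_certificate_pos`. Here `p = ρ + ρ⁻¹` and `c` describe
the point `z = ρ (c + i S)`, and `τ = 2 t`. At `c = 0`, `τ ^ 2 = 4` the polynomial is
`p ^ 2 (p ^ 2 - 24)`, so that the bound on `p` is sharp. -/
theorem koebe_quartic_pos {p c τ : ℝ} (hp : 0 < p) (ha : 24 < p ^ 2) (hc : c ^ 2 ≤ 1)
    (hτ : τ ^ 2 ≤ 4) :
    0 < (p ^ 4 - 16 - 6 * p ^ 2 * τ ^ 2 + τ ^ 4) + p * c * τ * (56 - 2 * p ^ 2 - 2 * τ ^ 2)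
      + c ^ 2 * (2 * p ^ 4 - 24 * p ^ 2 - 32 - 24 * τ ^ 2 + 12 * p ^ 2 * τ ^ 2 + 2 * τ ^ 4)
      - p * c ^ 3 * τ * (24 + 4 * p ^ 2 + 4 * τ ^ 2) + 80 * c ^ 4 + 16 * p * c ^ 5 * τ
      - 32 * c ^ 6 := by
  have hp4 : 4.89 < p := by nlinarith
  have hw2 : |τ| ^ 2 = τ ^ 2 := sq_abs τ
  have hw4 : |τ| ^ 4 = τ ^ 4 := by rw [show |τ| ^ 4 = (|τ| ^ 2) ^ 2 by ring, hw2]; ring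
  have hw1 : |τ| ≤ 2 := abs_le_of_sq_le_sq' (by linarith) (by norm_num) |> abs_le.2
  have hsw : |p * c * τ| ≤ p * |τ| := by
    rw [abs_mul, abs_mul, abs_of_pos hp]
    have := mul_le_mul_of_nonneg_right ((sq_le_one_iff_abs_le_one c).1 hc) (abs_nonneg τ)
    nlinarith
  obtain ⟨hs1, hs2⟩ := abs_le.1 hsw
  have hpw : p * |τ| ≤ p * 2 := mul_le_mul_of_nonneg_left hw1 hp.le
  -- once `c ^ 2` and `τ ^ 2` are fixed, everything is linear in `p * c * τ`
  have h1 : 0 < (p ^ 2 - 24) * (p ^ 2 - 2 * (p * c * τ)) :=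
    mul_pos (by linarith) (by nlinarith only [hs2, hpw, hp4])
  have h2 : 0 ≤ (4 - τ ^ 2) * (6 * p ^ 2 - 4 - τ ^ 2 + 2 * (p * c * τ)) :=
    mul_nonneg (by linarith) (by nlinarith only [hs1, hpw, hp4, hτ])
  have h3 := mul_nonneg (sq_nonneg c)
    (koebe_bracket_nonneg hp4 (abs_nonneg τ) hw1 (sq_nonneg c) hc hs2)
  have h4 : 0 ≤ c ^ 4 * (80 - 32 * c ^ 2) := mul_nonneg (by positivity) (by linarith)
  rw [hw2, hw4] at h3
  refine (add_pos_of_pos_of_nonneg h1 (add_nonneg h2 (add_nonneg h3 h4))).trans_eq ?_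
  ring

theorem im_div_pow_three (a d : ℂ) :
    (a / d ^ 3).im = (a * (starRingEnd ℂ d) ^ 3).im / normSq d ^ 3 := by
  rw [div_eq_mul_inv, Complex.inv_def, map_pow, map_pow, ← mul_assoc, im_mul_ofReal]
  rfl

theorem re_div_pow_two (a d : ℂ) :
    (a / d ^ 2).re = (a * (starRingEnd ℂ d) ^ 2).re / normSq d ^ 2 := by
  rw [div_eq_mul_inv, Complex.inv_def, map_pow, map_pow, ← mul_assoc, re_mul_ofReal]
  rfl

/-- For the kernel `k (z) = z / (1 - 2 t z + z²)` and `z = ρ (c + i S)`, put `u = z + z⁻¹` and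
`v = z⁻¹ - z`. Then `z k' = v / (u - 2 t) ^ 2` and
`z (z k')' = (u ^ 2 + 2 t u - 8) / (u - 2 t) ^ 3`. The multiplier `2 c S = sin (2 arg z)` serves all
`t` at once. -/
theorem koebe_certificate_pos {p q c S t : ℝ} (hp : 0 < p) (hq : 0 < q) (hpq : q ^ 2 = p ^ 2 - 4)
    (ha : 24 < p ^ 2) (hcS : S ^ 2 = 1 - c ^ 2) (hS : S ≠ 0) (ht : t ∈ Icc (-1 : ℝ) 1)
    {u v : ℂ} (hu : u = ⟨p * c, -(q * S)⟩) (hv : v = ⟨q * c, -(p * S)⟩) :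
    0 < S * (((u ^ 2 + 2 * t * u - 8) / (u - 2 * t) ^ 3).im
      + 2 * c * S * (v / (u - 2 * t) ^ 2).re) := by
  have hqS : q * S ≠ 0 := mul_ne_zero hq.ne' hS
  have hd : 0 < normSq (u - 2 * t) := by
    rw [normSq_pos]
    intro h
    have := congrArg Complex.im h
    simp [hu] at this
    exact this.elim hq.ne' hS
  rw [im_div_pow_three, re_div_pow_two]
  set D := normSq (u - 2 * t) with hD
  have hDval : D = (p * c - 2 * t) ^ 2 + (q * S) ^ 2 := by
    rw [hD, normSq_apply, hu]; simp; ring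
  have key := koebe_quartic_pos (c := c) (τ := 2 * t) hp ha (by nlinarith [sq_nonneg S])
    (by nlinarith [ht.1, ht.2])
  have e : S * (((u ^ 2 + 2 * t * u - 8) * (starRingEnd ℂ (u - 2 * t)) ^ 3).im / D ^ 3
      + 2 * c * S * ((v * (starRingEnd ℂ (u - 2 * t)) ^ 2).re / D ^ 2))
      = S * (((u ^ 2 + 2 * t * u - 8) * (starRingEnd ℂ (u - 2 * t)) ^ 3).im
      + 2 * c * S * D * (v * (starRingEnd ℂ (u - 2 * t)) ^ 2).re) / D ^ 3 := by
    field_simp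
  rw [e]
  refine div_pos ?_ (by positivity)
  have him : ((u ^ 2 + 2 * t * u - 8) * (starRingEnd ℂ (u - 2 * t)) ^ 3).im
      = q * S * (((p * c) ^ 2 + q ^ 2 * S ^ 2) ^ 2 - 24 * (p * c) ^ 2 + 8 * (q ^ 2 * S ^ 2)
        + 2 * (p * c) * ((p * c) ^ 2 + q ^ 2 * S ^ 2 + 24) * (2 * t)
        - 6 * ((p * c) ^ 2 + q ^ 2 * S ^ 2 + 4) * (2 * t) ^ 2 + 2 * (p * c) * (2 * t) ^ 3
        + (2 * t) ^ 4) := by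
    simp [hu, pow_succ]; ring
  have hre : (v * (starRingEnd ℂ (u - 2 * t)) ^ 2).re
      = q * (c * ((p * c - 2 * t) ^ 2 - q ^ 2 * S ^ 2) + 2 * p * S ^ 2 * (p * c - 2 * t)) := by
    simp [hu, hv, pow_succ]; ring
  rw [him, hre, hDval, mul_pow q S]
  refine (mul_pos (mul_pos hq (sq_pos_of_ne_zero hS)) key).trans_eq ?_
  have h6 : ∀ a b d : ℝ, S * (q * S * a + 2 * c * S * b * (q * d)) =
    q * S ^ 2 * (a + 2 * c * b * d) := by intros; ring
  rw [h6, hpq, hcS]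
  ring

/-- The certificate of unimodality for the kernels `z / (1 - 2 t z + z²)`, whose first derivative
and whose `(z k')'` are written out. -/
theorem exists_koebe_certificate {z : ℂ} (hz : ‖z‖ < √6 - √5) (him : z.im ≠ 0) :
    ∃ l : ℝ, ∀ t ∈ Icc (-1 : ℝ) 1,
      l * (z * ((1 - z ^ 2) / (1 - 2 * t * z + z ^ 2) ^ 2)).re <
        z.im * (z * ((z ^ 4 - 6 * z ^ 2 + 1 + 2 * t * z + 2 * t * z ^ 3) /
          (1 - 2 * t * z + z ^ 2) ^ 3)).im := by
  have hz0 : z ≠ 0 := by rintro rfl; simp at him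
  obtain ⟨ρ, hρ⟩ : ∃ ρ, ρ = ‖z‖ := ⟨_, rfl⟩
  have hρ0 : 0 < ρ := hρ ▸ norm_pos_iff.2 hz0
  rw [← hρ] at hz
  have h5 : √5 ^ 2 = 5 := Real.sq_sqrt (by norm_num)
  have h6 : √6 ^ 2 = 6 := Real.sq_sqrt (by norm_num)
  have h5' : 2 < √5 := by rw [Real.lt_sqrt] <;> norm_num
  have h6' : √6 < 2.5 := by rw [Real.sqrt_lt'] <;> norm_num
  have hρ1 : ρ < 1 := by linarith
  have hρsq : ρ ^ 2 = z.re ^ 2 + z.im ^ 2 := by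
    rw [hρ, ← normSq_eq_norm_sq, normSq_apply]; ring
  have hinv : 1 < ρ⁻¹ := (one_lt_inv₀ hρ0).2 hρ1
  have hmul : ρ * ρ⁻¹ = 1 := mul_inv_cancel₀ hρ0.ne'
  -- `√6 - √5` and `√6 + √5` are the roots of `x + x⁻¹ = 2 * √6`
  have hp : 2 * √6 < ρ + ρ⁻¹ := by
    have : √6 + √5 < ρ⁻¹ := by
      rw [lt_inv_comm₀ (by positivity) hρ0]
      refine hz.trans_eq (eq_inv_of_mul_eq_one_left ?_)
      ring_nf; linarith
    have h7 : 0 < (√6 - √5 - ρ) * (ρ⁻¹ - (√6 - √5)) := mul_pos (by linarith) (by linarith)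
    nlinarith
  have hzre : z.re = ρ * (z.re / ρ) := by field_simp
  have hzim : z.im = ρ * (z.im / ρ) := by field_simp
  set c := z.re / ρ
  set S := z.im / ρ
  have hcS : S ^ 2 = 1 - c ^ 2 := by
    rw [hzre, hzim] at hρsq
    have : 0 < ρ ^ 2 := by positivity
    have : ρ ^ 2 * (S ^ 2 - (1 - c ^ 2)) = 0 := by linarith
    nlinarith [(mul_eq_zero.1 this).resolve_left (by positivity)]
  have hS : S ≠ 0 := by rintro h; rw [h, mul_zero] at hzim; exact him hzim
  have hzinv : z⁻¹ = ⟨ρ⁻¹ * c, -(ρ⁻¹ * S)⟩ := by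
    have : normSq z = ρ ^ 2 := by rw [normSq_eq_norm_sq, hρ]
    apply Complex.ext
    · rw [inv_re, this, hzre]; field_simp
    · rw [inv_im, this, hzim]; field_simp
  refine ⟨-(2 * c * S) * z.im, fun t ht => ?_⟩
  have hu : z + z⁻¹ = ⟨(ρ + ρ⁻¹) * c, -((ρ⁻¹ - ρ) * S)⟩ := by
    rw [hzinv]; apply Complex.ext
    · simp only [add_re]; rw [hzre]; ring
    · simp only [add_im]; rw [hzim]; ring
  have hv : z⁻¹ - z = ⟨(ρ⁻¹ - ρ) * c, -((ρ + ρ⁻¹) * S)⟩ := by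
    rw [hzinv]; apply Complex.ext
    · simp only [sub_re]; rw [hzre]; ring
    · simp only [sub_im]; rw [hzim]; ring
  have key := koebe_certificate_pos (p := ρ + ρ⁻¹) (q := ρ⁻¹ - ρ) (by positivity) (by linarith)
    (by linear_combination -4 * hmul) (by nlinarith) hcS hS ht hu hv
  have hd : 1 - 2 * t * z + z ^ 2 = z * (z + z⁻¹ - 2 * t) := by field_simp; ring
  have hA : z * ((1 - z ^ 2) / (1 - 2 * t * z + z ^ 2) ^ 2)
      = (z⁻¹ - z) / (z + z⁻¹ - 2 * t) ^ 2 := by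
    rw [hd, mul_pow, ← mul_div_assoc, show z * (1 - z ^ 2) = z ^ 2 * (z⁻¹ - z) by field_simp,
      mul_div_mul_left _ _ (pow_ne_zero 2 hz0)]
  have hB : z * ((z ^ 4 - 6 * z ^ 2 + 1 + 2 * t * z + 2 * t * z ^ 3) /
      (1 - 2 * t * z + z ^ 2) ^ 3)
      = ((z + z⁻¹) ^ 2 + 2 * t * (z + z⁻¹) - 8) / (z + z⁻¹ - 2 * t) ^ 3 := by
    rw [hd, mul_pow, ← mul_div_assoc, show z * (z ^ 4 - 6 * z ^ 2 + 1 + 2 * t * z + 2 * t * z ^ 3)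
      = z ^ 3 * ((z + z⁻¹) ^ 2 + 2 * t * (z + z⁻¹) - 8) by field_simp; ring,
      mul_div_mul_left _ _ (pow_ne_zero 3 hz0)]
  rw [hA, hB, hzim]
  nlinarith

theorem re_inv_sq_pos {z : ℂ} (hz : |z.im| < z.re) : 0 < (1 / z ^ 2).re := by
  have h0 : 0 < normSq z := by
    rw [normSq_pos]; rintro rfl; simp at hz
  rw [re_div_pow_two]
  refine div_pos ?_ (by positivity)
  have : z.im ^ 2 < z.re ^ 2 := sq_lt_sq.2 (hz.trans_le (le_abs_self _))
  simp [pow_succ]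
  nlinarith

/-- The kernel `z / (1 - 2 t z + z²)` has a derivative with positive real part. The crude estimates
suffice since the disk is well inside the region where this holds. -/
theorem koebe_re_deriv_pos {z : ℂ} (hz : ‖z‖ < √6 - √5) {t : ℝ} (ht : t ∈ Icc (-1 : ℝ) 1) :
    0 < ((1 - z ^ 2) / (1 - 2 * t * z + z ^ 2) ^ 2).re := by
  have h5 : 2.236 < √5 := by rw [Real.lt_sqrt] <;> norm_num
  have h6 : √6 < 2.45 := by rw [Real.sqrt_lt'] <;> norm_num
  have hz1 : ‖z‖ < 0.214 := by linarith
  have hz2 : ‖z ^ 2‖ ≤ 0.046 := by rw [norm_pow]; nlinarith [norm_nonneg z]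
  have ht1 : |t| ≤ 1 := abs_le.2 ht
  have hd : ‖-2 * t * z + z ^ 2‖ ≤ 0.474 := by
    refine (norm_add_le _ _).trans ?_
    have : ‖-2 * t * z‖ ≤ 0.428 := by
      rw [norm_mul, norm_mul, norm_neg, norm_real, Real.norm_eq_abs]
      norm_num
      nlinarith [norm_nonneg z, abs_nonneg t]
    linarith
  obtain ⟨w, hw⟩ : ∃ w, w = -2 * t * z + z ^ 2 := ⟨_, rfl⟩
  obtain ⟨y, hy⟩ : ∃ y, y = z ^ 2 := ⟨_, rfl⟩
  rw [← hw] at hd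
  rw [← hy] at hz2
  have e : (1 - z ^ 2) / (1 - 2 * t * z + z ^ 2) ^ 2 = (1 - y) / (1 + w) ^ 2 := by
    rw [hw, hy]; ring_nf
  have hw2 : w.re ^ 2 + w.im ^ 2 ≤ 0.225 := by
    have : ‖w‖ ^ 2 = w.re ^ 2 + w.im ^ 2 := by rw [← normSq_eq_norm_sq, normSq_apply]; ring
    nlinarith [norm_nonneg w]
  have hwr : -0.474 ≤ w.re := by linarith [neg_abs_le w.re, abs_re_le_norm w]
  have hpos : 0 < normSq (1 + w) := by
    rw [normSq_pos]; intro h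
    have := congrArg Complex.re h
    simp at this
    linarith
  rw [e, re_div_pow_two]
  refine div_pos ?_ (by positivity)
  have h1 : |(y * (starRingEnd ℂ (1 + w)) ^ 2).re| ≤ 0.046 * ((1 + w.re) ^ 2 + w.im ^ 2) := by
    refine (abs_re_le_norm _).trans ?_
    rw [norm_mul, norm_pow, Complex.norm_conj, ← normSq_eq_norm_sq]
    have : normSq (1 + w) = (1 + w.re) ^ 2 + w.im ^ 2 := by rw [normSq_apply]; simp; ring
    rw [← this]
    exact mul_le_mul_of_nonneg_right hz2 hpos.le
  have h2 : ((starRingEnd ℂ (1 + w)) ^ 2).re = (1 + w.re) ^ 2 - w.im ^ 2 := by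
    simp [pow_succ]
  rw [sub_mul, one_mul, sub_re, h2]
  have := (abs_le.1 h1).2
  nlinarith [sq_nonneg (w.re + 0.474)]

theorem cauchy_re_deriv_pos {z : ℂ} (hz : ‖z‖ < √2 - 1) {t : ℝ} (ht : t ∈ Icc (-1 : ℝ) 1) :
    0 < (1 / (1 - t * z) ^ 2).re := by
  apply re_inv_sq_pos
  have h2 : √2 < 1.5 := by rw [Real.sqrt_lt'] <;> norm_num
  have h : ‖(t : ℂ) * z‖ < 0.5 := by
    rw [norm_mul, norm_real, Real.norm_eq_abs]
    nlinarith [abs_le.2 ht, norm_nonneg z, abs_nonneg t]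
  have h3 := (abs_le.1 (abs_re_le_norm ((t : ℂ) * z))).2
  have h4 := abs_im_le_norm ((t : ℂ) * z)
  rw [sub_im, sub_re, one_im, zero_sub, abs_neg, one_re]
  linarith

/-- The polynomial inequality behind `exists_cauchy_certificate`. With the multiplier chosen there,
the terms that are odd in `t` cancel. -/
theorem cauchy_quadratic_pos {X N t : ℝ} (hN : 0 < N) (hN' : 8 * N < (N + 1) ^ 2)
    (ht : t ∈ Icc (-1 : ℝ) 1) (hN1 : 1 < N) :
    0 < (N + X ^ 2) * ((N - t ^ 2) ^ 2 + 2 * t * (X * (N + t ^ 2) - 2 * N * t))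
      + X * (N + t ^ 2 - 2 * X * t) * (X * (N + t ^ 2) - 2 * N * t) := by
  have e : (N + X ^ 2) * ((N - t ^ 2) ^ 2 + 2 * t * (X * (N + t ^ 2) - 2 * N * t))
      + X * (N + t ^ 2 - 2 * X * t) * (X * (N + t ^ 2) - 2 * N * t)
      = N * ((N + t ^ 2) ^ 2 - 8 * N * t ^ 2) + 2 * X ^ 2 * ((N + t ^ 2) ^ 2 - 2 * N * t ^ 2) := by
    ring
  have ht2 : t ^ 2 ≤ 1 := by nlinarith [ht.1, ht.2]
  have h1 : 0 < (N + t ^ 2) ^ 2 - 8 * N * t ^ 2 := by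
    nlinarith [mul_nonneg (sub_nonneg.2 ht2) hN.le, sq_nonneg t,
      mul_nonneg (sub_nonneg.2 ht2) (sq_nonneg t),
      mul_nonneg (sub_nonneg.2 ht2) (sub_nonneg.2 hN1.le)]
  have h2 : 0 ≤ (N + t ^ 2) ^ 2 - 2 * N * t ^ 2 := by nlinarith [sq_nonneg t, sq_nonneg (t ^ 2)]
  rw [e]
  positivity

/-- The certificate of unimodality for the kernels `z / (1 - t z)`, whose first derivative and
whose `(z k')'` are written out. The multiplier is a multiple of `X / (N + X ^ 2)`, where
`X = Re z⁻¹` and `N = |z⁻¹| ^ 2`. -/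
theorem exists_cauchy_certificate {z : ℂ} (hz : ‖z‖ < √2 - 1) (him : z.im ≠ 0) :
    ∃ l : ℝ, ∀ t ∈ Icc (-1 : ℝ) 1,
      l * (z * (1 / (1 - t * z) ^ 2)).re <
        z.im * (z * ((1 + t * z) / (1 - t * z) ^ 3)).im := by
  have hz0 : z ≠ 0 := by rintro rfl; simp at him
  have h2 : √2 ^ 2 = 2 := Real.sq_sqrt (by norm_num)
  obtain ⟨b, hb⟩ : ∃ b, b = z⁻¹ := ⟨_, rfl⟩
  have hzb : z = b⁻¹ := by rw [hb, inv_inv]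
  have hb0 : b ≠ 0 := hb ▸ inv_ne_zero hz0
  obtain ⟨N, hN⟩ : ∃ N, N = normSq b := ⟨_, rfl⟩
  have hNb : N = b.re ^ 2 + b.im ^ 2 := by rw [hN, normSq_apply]; ring
  have hN0 : 0 < N := hN ▸ normSq_pos.2 hb0
  -- `(√2 - 1)⁻¹ = √2 + 1`, whose square is a root of `(N + 1) ^ 2 = 8 * N`
  have hbn : √2 + 1 < ‖b‖ := by
    rw [hb, norm_inv, lt_inv_comm₀ (by positivity) (norm_pos_iff.2 hz0)]
    refine hz.trans_eq (eq_inv_of_mul_eq_one_left ?_)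
    ring_nf; linarith
  have hNgt : 3 + 2 * √2 < N := by
    rw [hN, normSq_eq_norm_sq]; nlinarith [Real.sqrt_nonneg 2]
  have hN8 : 8 * N < (N + 1) ^ 2 := by nlinarith [Real.sqrt_nonneg 2]
  have hbim : b.im ≠ 0 := by
    intro h
    apply him
    rw [hzb, inv_im, h]; simp
  have hzim : z.im = -b.im / N := by rw [hzb, inv_im, hN]
  refine ⟨-(b.re / (N + b.re ^ 2)) * (b.im ^ 2 / N), fun t ht => ?_⟩
  have hd : 0 < normSq (b - t) := by
    rw [normSq_pos]
    intro h
    have := congrArg Complex.im h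
    simp at this
    exact hbim this
  have hA : z * (1 / (1 - t * z) ^ 2) = b / (b - t) ^ 2 := by
    rw [show 1 - t * z = b⁻¹ * (b - t) by rw [hzb]; field_simp, hzb]
    field_simp
  have hB : z * ((1 + t * z) / (1 - t * z) ^ 3) = b * (b + t) / (b - t) ^ 3 := by
    rw [show 1 - t * z = b⁻¹ * (b - t) by rw [hzb]; field_simp, hzb]
    field_simp
  rw [hA, hB, hzim, im_div_pow_three, re_div_pow_two]
  have hD : normSq (b - t) = N + t ^ 2 - 2 * b.re * t := by
    rw [normSq_apply, hNb]; simp; ring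
  have hre : (b * (starRingEnd ℂ (b - t)) ^ 2).re = b.re * (N + t ^ 2) - 2 * N * t := by
    rw [hNb]; simp [pow_succ]; ring
  have him' : (b * (b + t) * (starRingEnd ℂ (b - t)) ^ 3).im
      = -b.im * ((N - t ^ 2) ^ 2 + 2 * t * (b.re * (N + t ^ 2) - 2 * N * t)) := by
    rw [hNb]; simp [pow_succ]; ring
  have key := cauchy_quadratic_pos (X := b.re) hN0 hN8 ht (by linarith [Real.sqrt_nonneg 2])
  rw [hre, him']
  rw [← hD] at key
  set D := normSq (b - t)
  rw [← sub_pos]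
  have hNX : 0 < N + b.re ^ 2 := by positivity
  have e := div_pos (mul_pos (pow_pos (abs_pos.2 hbim) 2) key)
    (mul_pos (mul_pos hN0 hNX) (pow_pos hd 3))
  rw [sq_abs] at e
  refine e.trans_eq ?_
  field_simp
  ring

/-! ### Analytic shears -/

theorem re_div_sub_pos {a b : ℂ} (h : ‖b‖ < ‖a‖) : 0 < ((a + b) / (a - b)).re := by
  have hab : 0 < normSq (a - b) := by
    rw [normSq_pos, sub_ne_zero]; rintro rfl; exact lt_irrefl _ h
  have h2 : normSq b < normSq a := by
    rw [normSq_eq_norm_sq, normSq_eq_norm_sq]; gcongr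
  have e : ((a + b) / (a - b)).re = (normSq a - normSq b) / normSq (a - b) := by
    rw [div_re, ← add_div]
    congr 1
    simp only [normSq_apply, add_re, sub_re, add_im, sub_im]; ring
  rw [e]
  exact div_pos (sub_pos.2 h2) hab

/-- The Noshiro-Warschawski theorem. -/
theorem injOn_of_re_deriv_pos {U : Set ℂ} (hU : IsOpen U) (hc : Convex ℝ U) {Φ : ℂ → ℂ}
    (hΦ : DifferentiableOn ℂ Φ U) (hpos : ∀ z ∈ U, 0 < (deriv Φ z).re) : InjOn Φ U := by
  intro z₁ h₁ z₂ h₂ heq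
  by_contra hne
  have hd : 0 < normSq (z₂ - z₁) := normSq_pos.2 (sub_ne_zero.2 (Ne.symm hne))
  have hmem : ∀ s ∈ Icc (0 : ℝ) 1, z₁ + s * (z₂ - z₁) ∈ U := fun s hs => by
    simpa using hc.add_smul_sub_mem h₁ h₂ hs
  have hder : ∀ s ∈ Icc (0 : ℝ) 1,
      HasDerivAt (fun s : ℝ => (conj (z₂ - z₁) * Φ (z₁ + s * (z₂ - z₁))).re)
        (normSq (z₂ - z₁) * (deriv Φ (z₁ + s * (z₂ - z₁))).re) s := fun s hs => by
    have h3 := (hΦ.differentiableAt (hU.mem_nhds (hmem s hs))).hasDerivAt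
    have h4 : HasDerivAt (fun w : ℂ => z₁ + w * (z₂ - z₁)) (z₂ - z₁) (s : ℂ) := by
      simpa using ((hasDerivAt_id (s : ℂ)).mul_const (z₂ - z₁)).const_add z₁
    have h5 := ((h3.comp (s : ℂ) h4).const_mul (conj (z₂ - z₁))).real_of_complex
    refine h5.congr_deriv ?_
    rw [← re_ofReal_mul, normSq_eq_conj_mul_self]
    ring_nf
  have hmono : StrictMonoOn (fun s : ℝ => (conj (z₂ - z₁) * Φ (z₁ + s * (z₂ - z₁))).re)
      (Icc 0 1) := by
    refine strictMonoOn_of_deriv_pos (convex_Icc 0 1)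
      (fun s hs => (hder s hs).continuousAt.continuousWithinAt) fun s hs => ?_
    rw [interior_Icc] at hs
    rw [(hder s (Ioo_subset_Icc_self hs)).deriv]
    exact mul_pos hd (hpos _ (hmem s (Ioo_subset_Icc_self hs)))
  have := hmono (left_mem_Icc.2 zero_le_one) (right_mem_Icc.2 zero_le_one) zero_lt_one
  simp [heq] at this

/-- The shear principle: if the horizontal segment between the images of two points under the
injective map `H - G` lies in the image of `U`, then `H + conj G` separates these points, since its
real part increases along the preimage of the segment. -/
theorem eq_of_segment_subset_image {U : Set ℂ} (hU : IsOpen U) {H G : ℂ → ℂ}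
    (hH : DifferentiableOn ℂ H U) (hG : DifferentiableOn ℂ G U)
    (hinj : InjOn (fun z => H z - G z) U) (hlt : ∀ z ∈ U, ‖deriv G z‖ < ‖deriv H z‖)
    {z₁ z₂ : ℂ} (h₁ : z₁ ∈ U) (h₂ : z₂ ∈ U)
    (hseg : ∀ s ∈ uIcc (H z₁ - G z₁).re (H z₂ - G z₂).re,
      ∃ w ∈ U, H w - G w = ⟨s, (H z₁ - G z₁).im⟩)
    (heq : H z₁ + conj (G z₁) = H z₂ + conj (G z₂)) : z₁ = z₂ := by
  have him : (H z₁ - G z₁).im = (H z₂ - G z₂).im := by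
    have := congrArg Complex.im heq
    simp only [add_im, conj_im] at this
    simp only [sub_im]; linarith
  set Φ : ℂ → ℂ := fun z => H z - G z with hΦ
  set v : ℝ := (H z₁ - G z₁).im with hv
  set g := Function.invFunOn Φ U with hg
  have hline : ∀ s : ℝ, (⟨s, v⟩ : ℂ) = s + v * I := fun s => by
    apply Complex.ext <;> simp
  have hgΦ : ∀ z ∈ U, g (Φ z) = z := fun z hz => hinj.leftInvOn_invFunOn hz
  have hder : ∀ s ∈ uIcc (Φ z₁).re (Φ z₂).re, ∃ d : ℝ, 0 < d ∧
      HasDerivAt (fun s : ℝ => (H (g (s + v * I)) + G (g (s + v * I))).re) d s := by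
    intro s hs
    obtain ⟨w, hwU, hw⟩ := hseg s hs
    rw [hline] at hw
    have hwU' := hU.mem_nhds hwU
    have hH' := (hH.analyticAt hwU').hasStrictDerivAt
    have hG' := (hG.analyticAt hwU').hasStrictDerivAt
    have hne : deriv H w - deriv G w ≠ 0 := sub_ne_zero.2 fun h => by
      have := hlt w hwU; rw [h] at this; exact lt_irrefl _ this
    have hinv : HasStrictDerivAt g (deriv H w - deriv G w)⁻¹ (Φ w) :=
      (hH'.sub hG').to_local_left_inverse hne
        (by filter_upwards [hwU'] with z hz using hgΦ z hz)
    have hgw : g (Φ w) = w := hgΦ w hwU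
    have hΦw : Φ w = s + v * I := hw
    have hadd : HasDerivAt (fun z => H z + G z) (deriv H w + deriv G w) (g (Φ w)) := by
      rw [hgw]; exact (hH'.add hG').hasDerivAt
    have hcomp := hadd.comp (Φ w) hinv.hasDerivAt
    rw [hΦw] at hcomp
    have htr : HasDerivAt (fun ζ : ℂ => ζ + v * I) 1 (s : ℂ) := (hasDerivAt_id _).add_const _
    have := (hcomp.comp (s : ℂ) htr).real_of_complex
    refine ⟨_, ?_, this⟩
    rw [mul_one, ← div_eq_mul_inv]
    exact re_div_sub_pos (hlt w hwU)
  have hmono : StrictMonoOn (fun s : ℝ => (H (g (s + v * I)) + G (g (s + v * I))).re)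
      (uIcc (Φ z₁).re (Φ z₂).re) := by
    refine strictMonoOn_of_deriv_pos (convex_uIcc _ _) (fun s hs => ?_) fun s hs => ?_
    · obtain ⟨d, -, hd⟩ := hder s hs
      exact hd.continuousAt.continuousWithinAt
    · obtain ⟨d, hd0, hd⟩ := hder s (interior_subset hs)
      rw [hd.deriv]; exact hd0
  have e₁ : ((Φ z₁).re : ℂ) + v * I = Φ z₁ := by rw [← hline]
  have e₂ : ((Φ z₂).re : ℂ) + v * I = Φ z₂ := by rw [← hline, him]
  have hre : (Φ z₁).re = (Φ z₂).re := by
    refine hmono.injOn left_mem_uIcc right_mem_uIcc ?_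
    simp only [e₁, e₂, hgΦ z₁ h₁, hgΦ z₂ h₂]
    have := congrArg Complex.re heq
    simpa using this
  exact hinj h₁ h₂ (by rw [← e₁, ← e₂, hre])

/-! ### Level curves and unimodality on circles -/

theorem im_lt_im_of_re_deriv_pos {U : Set ℂ} (hU : IsOpen U) (hc : Convex ℝ U) {Φ : ℂ → ℂ}
    (hΦ : DifferentiableOn ℂ Φ U) (hpos : ∀ z ∈ U, 0 < (deriv Φ z).re) {x y₁ y₂ : ℝ}
    (h₁ : (x + y₁ * I : ℂ) ∈ U) (h₂ : (x + y₂ * I : ℂ) ∈ U) (hlt : y₁ < y₂) :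
    (Φ (x + y₁ * I)).im < (Φ (x + y₂ * I)).im := by
  have hmem : ∀ y ∈ Icc y₁ y₂, (x + y * I : ℂ) ∈ U := fun y hy => by
    obtain ⟨a, b, ha, hb, hab, rfl⟩ := (segment_eq_Icc hlt.le ▸ hy : y ∈ segment ℝ y₁ y₂)
    convert hc h₁ h₂ ha hb hab using 1
    have : (a : ℂ) + b = 1 := by exact_mod_cast hab
    simp only [real_smul, smul_eq_mul, ofReal_add, ofReal_mul]
    linear_combination (-(x : ℂ)) * this
  have hder : ∀ y ∈ Icc y₁ y₂,
      HasDerivAt (fun y : ℝ => (Φ (x + y * I)).im) (deriv Φ (x + y * I)).re y := fun y hy => by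
    have h3 := (hΦ.differentiableAt (hU.mem_nhds (hmem y hy))).hasDerivAt
    have h4 : HasDerivAt (fun w : ℂ => x + w * I) I (y : ℂ) := by
      simpa using ((hasDerivAt_id (y : ℂ)).mul_const I).const_add (x : ℂ)
    have h5 := ((h3.comp (y : ℂ) h4).mul_const (-I)).real_of_complex
    convert h5 using 1
    · ext y; simp
    · simp
  refine strictMonoOn_of_deriv_pos (convex_Icc y₁ y₂)
      (fun s hs => (hder s hs).continuousAt.continuousWithinAt) (fun s hs => ?_)
      (left_mem_Icc.2 hlt.le) (right_mem_Icc.2 hlt.le) hlt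
  rw [interior_Icc] at hs
  rw [(hder s (Ioo_subset_Icc_self hs)).deriv]
  exact hpos _ (hmem s (Ioo_subset_Icc_self hs))

/-- A function whose critical points are strict local maxima exceeds on an interval any value that
it exceeds at both ends. -/
theorem lt_of_lt_of_deriv_deriv_neg {u : ℝ → ℝ} (hu : Continuous u) {a b θ m : ℝ}
    (hcrit : ∀ x ∈ Ioo a b, deriv u x = 0 → deriv (deriv u) x < 0) (hθ : θ ∈ Icc a b)
    (ha : m < u a) (hb : m < u b) : m < u θ := by
  by_contra! hle
  obtain ⟨x, hx, hmin⟩ := isCompact_Icc.exists_isMinOn ⟨θ, hθ⟩ hu.continuousOn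
  have hxm : u x ≤ m := (hmin hθ).trans hle
  have hxI : x ∈ Ioo a b :=
    ⟨hx.1.lt_of_ne (by rintro rfl; linarith), hx.2.lt_of_ne (by rintro rfl; linarith)⟩
  have hloc : IsLocalMin u x := hmin.isLocalMin (Icc_mem_nhds hxI.1 hxI.2)
  have hd0 := hloc.deriv_eq_zero
  have hd2 := hcrit x hxI hd0
  have hmax := isLocalMax_of_deriv_deriv_neg hd2 hd0 hu.continuousAt
  have hconst : u =ᶠ[𝓝 x] fun _ => u x := by
    filter_upwards [hloc, hmax] with y h1 h2 using le_antisymm h2 h1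
  have := hconst.deriv.deriv_eq
  simp at this
  linarith

/-- `Im Φ` is unimodal along the upper half of a circle. As a function of the angle it has
derivative `Re (z Φ')` and second derivative `- Im (z (z Φ')')`. -/
theorem lt_im_circleMap_of_lt {Φ : ℂ → ℂ} {r R : ℝ} (hΦ : DifferentiableOn ℂ Φ (ball 0 r))
    (hR0 : 0 < R) (hR : R < r)
    (hcrit : ∀ z ∈ ball (0 : ℂ) r, 0 < z.im → (z * deriv Φ z).re = 0 →
      0 < (z * deriv (fun w => w * deriv Φ w) z).im)
    {a b θ m : ℝ} (ha0 : 0 ≤ a) (hbπ : b ≤ Real.pi) (hθ : θ ∈ Icc a b)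
    (ha : m < (Φ (circleMap 0 R a)).im) (hb : m < (Φ (circleMap 0 R b)).im) :
    m < (Φ (circleMap 0 R θ)).im := by
  have hmem : ∀ θ, circleMap 0 R θ ∈ ball (0 : ℂ) r := fun θ => by
    rw [mem_ball_zero_iff, norm_circleMap_zero, abs_of_pos hR0]; exact hR
  have hderiv : ∀ {Ψ : ℂ → ℂ}, DifferentiableOn ℂ Ψ (ball 0 r) → ∀ θ : ℝ,
      HasDerivAt (fun θ : ℝ => Ψ (circleMap 0 R θ))
        (deriv Ψ (circleMap 0 R θ) * (circleMap 0 R θ * I)) θ := fun hΨ θ =>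
    (hΨ.differentiableAt (isOpen_ball.mem_nhds (hmem θ))).hasDerivAt.comp θ
      (hasDerivAt_circleMap 0 R θ)
  have him : ∀ {v : ℝ → ℂ} {v' : ℂ} {θ : ℝ}, HasDerivAt v v' θ →
      HasDerivAt (fun θ => (v θ).im) v'.im θ := fun h =>
    (imCLM.hasFDerivAt.comp_hasDerivAt _ h)
  have hre : ∀ {v : ℝ → ℂ} {v' : ℂ} {θ : ℝ}, HasDerivAt v v' θ →
      HasDerivAt (fun θ => (v θ).re) v'.re θ := fun h =>
    (reCLM.hasFDerivAt.comp_hasDerivAt _ h)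
  have h1 : deriv (fun θ : ℝ => (Φ (circleMap 0 R θ)).im)
      = fun θ => (circleMap 0 R θ * deriv Φ (circleMap 0 R θ)).re := by
    ext θ
    rw [(him (hderiv hΦ θ)).deriv]
    simp; ring
  have hΦ' : DifferentiableOn ℂ (fun w => w * deriv Φ w) (ball 0 r) :=
    differentiableOn_id.mul (hΦ.deriv isOpen_ball)
  refine lt_of_lt_of_deriv_deriv_neg (u := fun θ : ℝ => (Φ (circleMap 0 R θ)).im)
    ?_ (fun x hx h0 => ?_) hθ ha hb
  · exact continuous_iff_continuousAt.2 fun θ => (him (hderiv hΦ θ)).continuousAt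
  · rw [h1] at h0 ⊢
    rw [(hre (hderiv hΦ' x)).deriv]
    have hpos : 0 < (circleMap 0 R x).im := by
      have : (circleMap 0 R x).im = R * Real.sin x := by
        simp [circleMap, exp_ofReal_mul_I_im]
      rw [this]
      exact mul_pos hR0 (Real.sin_pos_of_pos_of_lt_pi (by linarith [hx.1]) (by linarith [hx.2]))
    have := hcrit _ (hmem x) hpos h0
    rw [mul_im] at this
    simp only [mul_re, mul_im, I_re, I_im, mul_zero, mul_one, zero_sub, add_zero]
    linarith

/-- The level curve of `Im Φ` through two points of the upper half disk is the graph of a continuous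
function between them, so its image under `Φ` contains the segment joining the two image points. -/
theorem exists_mem_ball_of_mem_uIcc {Φ : ℂ → ℂ} {r : ℝ} (hΦ : DifferentiableOn ℂ Φ (ball 0 r))
    (hpos : ∀ z ∈ ball (0 : ℂ) r, 0 < (deriv Φ z).re)
    (hreal : ∀ x : ℝ, (x : ℂ) ∈ ball (0 : ℂ) r → (Φ x).im = 0)
    (hcrit : ∀ z ∈ ball (0 : ℂ) r, 0 < z.im → (z * deriv Φ z).re = 0 →
      0 < (z * deriv (fun w => w * deriv Φ w) z).im)
    {z₁ z₂ : ℂ} (h₁ : z₁ ∈ ball (0 : ℂ) r) (h₂ : z₂ ∈ ball (0 : ℂ) r) (hz₁ : 0 < z₁.im)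
    (hz₂ : 0 < z₂.im) (him : (Φ z₁).im = (Φ z₂).im) (hre : z₁.re < z₂.re) :
    ∀ s ∈ uIcc (Φ z₁).re (Φ z₂).re, ∃ w ∈ ball (0 : ℂ) r, Φ w = ⟨s, (Φ z₁).im⟩ := by
  set m := (Φ z₁).im with hm
  have hvert : ∀ {x y₁ y₂ : ℝ}, (x + y₁ * I : ℂ) ∈ ball (0 : ℂ) r →
      (x + y₂ * I : ℂ) ∈ ball (0 : ℂ) r → y₁ < y₂ →
      (Φ (x + y₁ * I)).im < (Φ (x + y₂ * I)).im :=
    im_lt_im_of_re_deriv_pos isOpen_ball (convex_ball 0 r) hΦ hpos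
  have hnorm : ∀ x y : ℝ, ‖(x + y * I : ℂ)‖ ^ 2 = x ^ 2 + y ^ 2 := fun x y => by
    rw [← normSq_eq_norm_sq, normSq_add_mul_I]
  have hcont : ContinuousOn Φ (ball 0 r) := hΦ.continuousOn
  -- both points lie in a disk of some radius `R < r`
  obtain ⟨R, hR₁, hR⟩ : ∃ R, max ‖z₁‖ ‖z₂‖ < R ∧ R < r :=
    exists_between (max_lt (mem_ball_zero_iff.1 h₁) (mem_ball_zero_iff.1 h₂))
  obtain ⟨hR1, hR2⟩ := max_lt_iff.1 hR₁
  have hR0 : 0 < R := (norm_nonneg _).trans_lt hR1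
  have hmem : ∀ {x y : ℝ}, x ^ 2 + y ^ 2 ≤ R ^ 2 → (x + y * I : ℂ) ∈ ball (0 : ℂ) r := by
    intro x y h
    rw [mem_ball_zero_iff]
    rw [← hnorm] at h
    exact (le_of_sq_le_sq h hR0.le).trans_lt hR
  have hz : ∀ {z : ℂ}, ‖z‖ < R → z.re ^ 2 + z.im ^ 2 < R ^ 2 := by
    intro z h
    have : ‖z‖ ^ 2 = z.re ^ 2 + z.im ^ 2 := by rw [← normSq_eq_norm_sq, normSq_apply]; ring
    rw [← this]; gcongr
  have hxR : ∀ x ∈ Icc z₁.re z₂.re, x ^ 2 < R ^ 2 := by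
    intro x hx
    have a1 := hz hR1
    have a2 := hz hR2
    have b1 := abs_lt_of_sq_lt_sq (by nlinarith [sq_nonneg z₁.im] : z₁.re ^ 2 < R ^ 2) hR0.le
    have b2 := abs_lt_of_sq_lt_sq (by nlinarith [sq_nonneg z₂.im] : z₂.re ^ 2 < R ^ 2) hR0.le
    rw [abs_lt] at b1 b2
    exact sq_lt_sq' (by linarith [hx.1]) (by linarith [hx.2])
  -- the end point on the upper half circle of the vertical chord at `x`
  have htop : ∀ x ∈ Icc z₁.re z₂.re,
      circleMap 0 R (Real.arccos (x / R)) = x + √(R ^ 2 - x ^ 2) * I := by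
    intro x hx
    have hx2 := hxR x hx
    have hb := abs_le.1 (abs_lt_of_sq_lt_sq hx2 hR0.le).le
    apply Complex.ext
    · simp only [circleMap, zero_add, re_ofReal_mul, exp_ofReal_mul_I_re, add_re, ofReal_re,
        mul_I_re, ofReal_im, neg_zero, add_zero]
      rw [Real.cos_arccos (by rw [le_div_iff₀ hR0]; linarith) (by rw [div_le_one hR0]; linarith)]
      field_simp
    · simp only [circleMap, zero_add, im_ofReal_mul, exp_ofReal_mul_I_im, add_im, ofReal_im,
        mul_I_im, ofReal_re]
      rw [Real.sin_arccos, show R ^ 2 - x ^ 2 = R ^ 2 * (1 - (x / R) ^ 2) by field_simp,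
        Real.sqrt_mul (sq_nonneg R), Real.sqrt_sq hR0.le]
  have hpt : ∀ z : ℂ, (z.re + z.im * I : ℂ) = z := re_add_im
  have hend : ∀ {z : ℂ}, 0 < z.im → ‖z‖ < R → (Φ z).im = m → z.re ∈ Icc z₁.re z₂.re →
      m < (Φ (circleMap 0 R (Real.arccos (z.re / R)))).im := by
    intro z h0 hzR hzm hzI
    rw [htop _ hzI, ← hzm]
    conv_lhs => rw [← hpt z]
    have := hz hzR
    refine hvert (hmem this.le) (hmem ?_) (Real.lt_sqrt_of_sq_lt (by linarith))
    rw [Real.sq_sqrt (by nlinarith [sq_nonneg z.im])]; linarith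
  have htopm : ∀ x ∈ Icc z₁.re z₂.re, m < (Φ (x + √(R ^ 2 - x ^ 2) * I)).im := by
    intro x hx
    rw [← htop x hx]
    refine lt_im_circleMap_of_lt hΦ hR0 hR hcrit (Real.arccos_nonneg _) (Real.arccos_le_pi _)
      ⟨Real.antitone_arccos ?_, Real.antitone_arccos ?_⟩
      (hend hz₂ hR2 him.symm (right_mem_Icc.2 hre.le)) (hend hz₁ hR1 rfl (left_mem_Icc.2 hre.le))
    · exact div_le_div_of_nonneg_right hx.2 hR0.le
    · exact div_le_div_of_nonneg_right hx.1 hR0.le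
  have hmpos : 0 < m := by
    have h0 : (z₁.re + (0 : ℝ) * I : ℂ) ∈ ball (0 : ℂ) r :=
      hmem (by nlinarith [hz hR1, sq_nonneg z₁.im])
    have := hvert h0 (by rw [hpt]; exact h₁) hz₁
    rw [hpt, ofReal_zero, zero_mul, add_zero, hreal _ (by simpa using h0)] at this
    exact this
  -- on each chord the level `m` is attained exactly once
  have hex : ∀ x ∈ Icc z₁.re z₂.re, ∃ y ∈ Ioo 0 √(R ^ 2 - x ^ 2), (Φ (x + y * I)).im = m := by
    intro x hx
    have hx2 := hxR x hx
    have hIcc : ∀ y ∈ Icc 0 √(R ^ 2 - x ^ 2), (x + y * I : ℂ) ∈ ball (0 : ℂ) r := by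
      intro y hy
      refine hmem ?_
      have := Real.sq_sqrt (sub_nonneg.2 hx2.le)
      nlinarith [hy.1, hy.2]
    have hc : ContinuousOn (fun y : ℝ => (Φ (x + y * I)).im) (Icc 0 √(R ^ 2 - x ^ 2)) :=
      continuous_im.comp_continuousOn (hcont.comp (by fun_prop) hIcc)
    have h0 : (Φ (x + (0 : ℝ) * I)).im < m := by
      have := hIcc 0 (left_mem_Icc.2 (Real.sqrt_nonneg _))
      simp only [ofReal_zero, zero_mul, add_zero] at this ⊢
      rw [hreal x this]; exact hmpos
    obtain ⟨y, hy, hym⟩ := intermediate_value_Ioo (Real.sqrt_nonneg _) hc ⟨h0, htopm x hx⟩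
    exact ⟨y, hy, hym⟩
  choose! Y hY hYm using hex
  have hYmem : ∀ x ∈ Icc z₁.re z₂.re, ∀ y ∈ Icc 0 √(R ^ 2 - x ^ 2),
      (x + y * I : ℂ) ∈ ball (0 : ℂ) r := by
    intro x hx y hy
    refine hmem ?_
    have := Real.sq_sqrt (sub_nonneg.2 (hxR x hx).le)
    nlinarith [hy.1, hy.2]
  have hYb : ∀ x ∈ Icc z₁.re z₂.re, (x + Y x * I : ℂ) ∈ ball (0 : ℂ) r := fun x hx =>
    hYmem x hx _ (Ioo_subset_Icc_self (hY x hx))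
  have hcontx : ∀ {x y : ℝ}, (x + y * I : ℂ) ∈ ball (0 : ℂ) r →
      ContinuousAt (fun x : ℝ => (Φ (x + y * I)).im) x ∧
        ∀ᶠ x' : ℝ in 𝓝 x, (x' + y * I : ℂ) ∈ ball (0 : ℂ) r := by
    intro x y h
    have hc : ContinuousAt (fun x : ℝ => (x + y * I : ℂ)) x := by fun_prop
    exact ⟨continuous_im.continuousAt.comp
      (ContinuousAt.comp (f := fun x : ℝ => (x + y * I : ℂ))
        (hcont.continuousAt (isOpen_ball.mem_nhds h)) hc),
      hc.eventually (isOpen_ball.mem_nhds h)⟩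
  have hYcont : ContinuousOn Y (Icc z₁.re z₂.re) := by
    intro x hx
    refine tendsto_order.2 ⟨fun a ha => ?_, fun b hb => ?_⟩
    · have ha' : max a 0 < Y x := max_lt ha (hY x hx).1
      have hin := hYmem x hx (max a 0) ⟨le_max_right _ _, (ha'.trans (hY x hx).2).le⟩
      have hlt := hvert hin (hYb x hx) ha'
      rw [hYm x hx] at hlt
      obtain ⟨c1, c2⟩ := hcontx hin
      filter_upwards [mem_nhdsWithin_of_mem_nhds (c1.eventually (gt_mem_nhds hlt)),
        mem_nhdsWithin_of_mem_nhds c2, self_mem_nhdsWithin] with x' h1 h2 hx'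
      by_contra! hle
      rcases (hle.trans (le_max_left a 0)).eq_or_lt with h | h
      · rw [← h, hYm x' hx'] at h1; exact lt_irrefl _ h1
      · have := hvert (hYb x' hx') h2 h
        rw [hYm x' hx'] at this
        exact lt_asymm this h1
    · obtain ⟨b', hb1, hb2⟩ := exists_between (lt_min hb (hY x hx).2)
      have hin := hYmem x hx b' ⟨(hY x hx).1.le.trans hb1.le, (hb2.le.trans (min_le_right _ _))⟩
      have hlt := hvert (hYb x hx) hin hb1
      rw [hYm x hx] at hlt
      obtain ⟨c1, c2⟩ := hcontx hin
      filter_upwards [mem_nhdsWithin_of_mem_nhds (c1.eventually (lt_mem_nhds hlt)),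
        mem_nhdsWithin_of_mem_nhds c2, self_mem_nhdsWithin] with x' h1 h2 hx'
      by_contra! hle
      rcases ((hb2.le.trans (min_le_left _ _)).trans hle).eq_or_lt with h | h
      · rw [h, hYm x' hx'] at h1; exact lt_irrefl _ h1
      · have := hvert h2 (hYb x' hx') h
        rw [hYm x' hx'] at this
        exact lt_asymm this h1
  have hYend : ∀ {z : ℂ}, z ∈ ball (0 : ℂ) r → (Φ z).im = m → z.re ∈ Icc z₁.re z₂.re →
      (z.re + Y z.re * I : ℂ) = z := by
    intro z hzb hzm hzI
    conv_rhs => rw [← hpt z]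
    rcases lt_trichotomy (Y z.re) z.im with h | h | h
    · have := hvert (hYb _ hzI) (by rwa [hpt]) h
      rw [hpt, hzm, hYm _ hzI] at this
      exact absurd this (lt_irrefl _)
    · rw [h]
    · have := hvert (by rwa [hpt]) (hYb _ hzI) h
      rw [hpt, hzm, hYm _ hzI] at this
      exact absurd this (lt_irrefl _)
  have hσ : ContinuousOn (fun x : ℝ => (Φ (x + Y x * I)).re) (uIcc z₁.re z₂.re) := by
    rw [uIcc_of_le hre.le]
    refine continuous_re.comp_continuousOn (hcont.comp ?_ hYb)
    exact continuous_ofReal.continuousOn.add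
      ((continuous_ofReal.comp_continuousOn hYcont).mul continuousOn_const)
  intro s hs
  have himg := intermediate_value_uIcc hσ
  rw [hYend h₁ rfl (left_mem_Icc.2 hre.le), hYend h₂ him.symm (right_mem_Icc.2 hre.le),
    uIcc_of_le hre.le] at himg
  obtain ⟨x, hx, hxs⟩ := himg hs
  exact ⟨_, hYb x hx, Complex.ext hxs (hYm x hx)⟩

theorem injOn_upper_half_ball {H G : ℂ → ℂ} {r : ℝ} (hH : DifferentiableOn ℂ H (ball 0 r))
    (hG : DifferentiableOn ℂ G (ball 0 r)) (hlt : ∀ z ∈ ball (0 : ℂ) r, ‖deriv G z‖ < ‖deriv H z‖)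
    (hpos : ∀ z ∈ ball (0 : ℂ) r, 0 < (deriv (fun w => H w - G w) z).re)
    (hreal : ∀ x : ℝ, (x : ℂ) ∈ ball (0 : ℂ) r → (H x - G x).im = 0)
    (hcrit : ∀ z ∈ ball (0 : ℂ) r, 0 < z.im → (z * deriv (fun w => H w - G w) z).re = 0 →
      0 < (z * deriv (fun w => w * deriv (fun w => H w - G w) w) z).im) :
    InjOn (fun z => H z + conj (G z)) (ball (0 : ℂ) r ∩ {z | 0 < z.im}) := by
  have hΦ : DifferentiableOn ℂ (fun w => H w - G w) (ball 0 r) := hH.sub hG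
  have hinj := injOn_of_re_deriv_pos isOpen_ball (convex_ball 0 r) hΦ hpos
  have main : ∀ z₁ ∈ ball (0 : ℂ) r ∩ {z | 0 < z.im}, ∀ z₂ ∈ ball (0 : ℂ) r ∩ {z | 0 < z.im},
      H z₁ + conj (G z₁) = H z₂ + conj (G z₂) → z₁.re ≤ z₂.re → z₁ = z₂ := by
    rintro z₁ ⟨h₁, i₁⟩ z₂ ⟨h₂, i₂⟩ heq hle
    have him : (H z₁ - G z₁).im = (H z₂ - G z₂).im := by
      have := congrArg Complex.im heq
      simp only [add_im, conj_im] at this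
      simp only [sub_im]; linarith
    rcases hle.lt_or_eq with hre | hre
    · exact eq_of_segment_subset_image isOpen_ball hH hG hinj hlt h₁ h₂
        (exists_mem_ball_of_mem_uIcc hΦ hpos hreal hcrit h₁ h₂ i₁ i₂ him hre) heq
    · refine Complex.ext hre ?_
      have hvert := fun {y₁ y₂ : ℝ} => im_lt_im_of_re_deriv_pos (x := z₁.re) (y₁ := y₁) (y₂ := y₂)
        isOpen_ball (convex_ball 0 r) hΦ hpos
      have e₁ : (z₁.re + z₁.im * I : ℂ) = z₁ := re_add_im z₁
      have e₂ : (z₁.re + z₂.im * I : ℂ) = z₂ := by rw [hre]; exact re_add_im z₂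
      rcases lt_trichotomy z₁.im z₂.im with h | h | h
      · have := hvert (by rwa [e₁]) (by rwa [e₂]) h
        rw [e₁, e₂] at this; exact absurd him this.ne
      · exact h
      · have := hvert (by rwa [e₂]) (by rwa [e₁]) h
        rw [e₁, e₂] at this; exact absurd him this.ne'
  intro z₁ h₁ z₂ h₂ heq
  rcases le_total z₁.re z₂.re with h | h
  · exact main z₁ h₁ z₂ h₂ heq h
  · exact (main z₂ h₂ z₁ h₁ heq.symm h).symm

/-- A criterion for the injectivity of the harmonic function `H + conj G` on a disk. -/
theorem injOn_ball {H G : ℂ → ℂ} {r : ℝ} (hH : DifferentiableOn ℂ H (ball 0 r))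
    (hG : DifferentiableOn ℂ G (ball 0 r)) (hlt : ∀ z ∈ ball (0 : ℂ) r, ‖deriv G z‖ < ‖deriv H z‖)
    (hpos : ∀ z ∈ ball (0 : ℂ) r, 0 < (deriv (fun w => H w - G w) z).re)
    (hreal : ∀ x : ℝ, (x : ℂ) ∈ ball (0 : ℂ) r → (H x - G x).im = 0)
    (hcrit : ∀ z ∈ ball (0 : ℂ) r, z.im ≠ 0 → (z * deriv (fun w => H w - G w) z).re = 0 →
      0 < z.im * (z * deriv (fun w => w * deriv (fun w => H w - G w) w) z).im) :
    InjOn (fun z => H z + conj (G z)) (ball (0 : ℂ) r) := by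
  have hneg : MapsTo (fun z : ℂ => -z) (ball 0 r) (ball 0 r) := fun z hz => by simpa using hz
  have hΦ : DifferentiableOn ℂ (fun w => H w - G w) (ball 0 r) := hH.sub hG
  have hinj := injOn_of_re_deriv_pos isOpen_ball (convex_ball 0 r) hΦ hpos
  have hup := injOn_upper_half_ball hH hG hlt hpos hreal fun z hz hi h0 =>
    pos_of_mul_pos_right (hcrit z hz hi.ne' h0) hi.le
  -- the lower half disk is treated by passing to `-H (-z)` and `-G (-z)`
  have hd : ∀ (Ψ : ℂ → ℂ) (z : ℂ), deriv (fun w => -Ψ (-w)) z = deriv Ψ (-z) := fun Ψ z => by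
    rw [deriv.fun_neg, deriv_comp_neg, neg_neg]
  have hdΦ : ∀ z, deriv (fun w => -H (-w) - -G (-w)) z = deriv (fun w => H w - G w) (-z) :=
    fun z => by
      rw [← hd (fun w => H w - G w) z]
      congr 1; ext w; ring
  have hlow : InjOn (fun z => -H (-z) + conj (-G (-z))) (ball (0 : ℂ) r ∩ {z | 0 < z.im}) := by
    refine injOn_upper_half_ball (H := fun z => -H (-z)) (G := fun z => -G (-z))
      (hH.comp differentiableOn_id.neg hneg).neg
      (hG.comp differentiableOn_id.neg hneg).neg (fun z hz => ?_) (fun z hz => ?_)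
      (fun x hx => ?_) (fun z hz hi h0 => ?_)
    · rw [hd, hd]; exact hlt _ (hneg hz)
    · rw [hdΦ]; exact hpos _ (hneg hz)
    · have := hreal (-x) (by simpa using hneg hx)
      simp only [ofReal_neg, sub_im, neg_im] at this ⊢
      linarith
    · rw [hdΦ] at h0
      have e : deriv (fun w => w * deriv (fun w => -H (-w) - -G (-w)) w) z
          = deriv (fun w => w * deriv (fun w => H w - G w) w) (-z) := by
        rw [← hd (fun w => w * deriv (fun w => H w - G w) w) z]
        congr 1; ext w; rw [hdΦ]; ring
      rw [e]
      have := hcrit (-z) (hneg hz) (by simpa using hi.ne')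
        (by rw [neg_mul, neg_re, h0, neg_zero])
      rw [neg_im, neg_mul z, neg_im] at this
      exact pos_of_mul_pos_right (by linarith) hi.le
  have sign : ∀ z ∈ ball (0 : ℂ) r, SignType.sign (H z - G z).im = SignType.sign z.im := by
    intro z hz
    have hz0 : ((z.re : ℝ) : ℂ) ∈ ball (0 : ℂ) r := by
      rw [mem_ball_zero_iff] at hz ⊢
      rw [norm_real]
      exact (abs_re_le_norm z).trans_lt hz
    have hvert := fun {y₁ y₂ : ℝ} => im_lt_im_of_re_deriv_pos (x := z.re) (y₁ := y₁) (y₂ := y₂)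
        isOpen_ball (convex_ball 0 r) hΦ hpos
    have e : (z.re + z.im * I : ℂ) = z := re_add_im z
    have e0 : (z.re + (0 : ℝ) * I : ℂ) = (z.re : ℝ) := by simp
    rcases lt_trichotomy z.im 0 with h | h | h
    · have := hvert (by rwa [e]) (by rwa [e0]) h
      rw [e, e0, hreal _ hz0] at this
      rw [sign_neg h, sign_neg this]
    · have e1 : z = (z.re : ℝ) := Complex.ext rfl (by simpa using h)
      rw [h, e1, hreal _ hz0]
    · have := hvert (by rwa [e0]) (by rwa [e]) h
      rw [e, e0, hreal _ hz0] at this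
      rw [sign_pos h, sign_pos this]
  intro z₁ h₁ z₂ h₂ heq
  have him : (H z₁ - G z₁).im = (H z₂ - G z₂).im := by
    have := congrArg Complex.im heq
    simp only [add_im, conj_im] at this
    simp only [sub_im]; linarith
  have hs := sign z₁ h₁
  rw [him, sign z₂ h₂] at hs
  rcases lt_trichotomy z₁.im 0 with h | h | h
  · have h' : z₂.im < 0 := by rw [sign_neg h] at hs; exact sign_eq_neg_one_iff.1 hs
    have := hlow (x₁ := -z₁) (x₂ := -z₂) ⟨hneg h₁, by simpa using h⟩ ⟨hneg h₂, by simpa using h'⟩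
      (by simp only [neg_neg, map_neg] at heq ⊢; linear_combination -heq)
    exact neg_injective this
  · have h' : z₂.im = 0 := by rw [h, sign_zero] at hs; exact sign_eq_zero_iff.1 hs
    refine eq_of_segment_subset_image isOpen_ball hH hG hinj hlt h₁ h₂ (fun s hs => ?_) heq
    have e₁ : ((z₁.re : ℝ) : ℂ) = z₁ := Complex.ext rfl (by simpa using h.symm)
    have e₂ : ((z₂.re : ℝ) : ℂ) = z₂ := Complex.ext rfl (by simpa using h'.symm)
    have hseg : ∀ x ∈ uIcc z₁.re z₂.re, (x : ℂ) ∈ ball (0 : ℂ) r := fun x hx => by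
      rw [mem_ball_zero_iff, norm_real, ← mem_ball_zero_iff]
      refine (convex_ball (0 : ℝ) r).ordConnected.uIcc_subset ?_ ?_ hx
      · rwa [mem_ball_zero_iff, ← norm_real, e₁, ← mem_ball_zero_iff]
      · rwa [mem_ball_zero_iff, ← norm_real, e₂, ← mem_ball_zero_iff]
    have hσ : ContinuousOn (fun x : ℝ => (H x - G x).re) (uIcc z₁.re z₂.re) :=
      continuous_re.comp_continuousOn
        (hΦ.continuousOn.comp continuous_ofReal.continuousOn hseg)
    have himg := intermediate_value_uIcc hσ
    rw [e₁, e₂] at himg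
    obtain ⟨x, hx, hxs⟩ := himg hs
    refine ⟨x, hseg x hx, Complex.ext hxs ?_⟩
    rw [hreal x (hseg x hx), ← e₁, hreal _ (by rwa [e₁])]
  · have h' : 0 < z₂.im := by rw [sign_pos h] at hs; exact sign_eq_one_iff.1 hs
    exact hup ⟨h₁, h⟩ ⟨h₂, h'⟩ heq

/-! ### Integral representation -/

/-- An analytic function that is real on the real axis and vanishes at the origin is a
superposition of the kernels `z / (1 - 2 t z + z²)`, `t = cos θ`, with weight
`Im χ (exp (i θ)) sin θ`. This is Cauchy's formula for
`w ↦ χ (w) (w ^ 2 - 1) z / (w (1 - z w))`, combined with its reflection in the real axis. -/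
theorem schwarz_integral_formula {χ : ℂ → ℂ} {ρ : ℝ} (hρ : 1 < ρ)
    (hχ : DifferentiableOn ℂ χ (ball 0 ρ)) (h0 : χ 0 = 0)
    (hconj : ∀ w ∈ ball (0 : ℂ) ρ, χ (conj w) = conj (χ w)) {z : ℂ} (hz : ‖z‖ < 1) :
    ∫ θ in (0 : ℝ)..2 * Real.pi, (((χ (circleMap 0 1 θ)).im * Real.sin θ : ℝ) : ℂ) *
      (z / (1 - 2 * Real.cos θ * z + z ^ 2)) = Real.pi * χ z := by
  have hsub : closedBall (0 : ℂ) 1 ⊆ ball 0 ρ := closedBall_subset_ball hρ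
  have hcb : ∀ θ : ℝ, circleMap 0 1 θ ∈ closedBall (0 : ℂ) 1 := fun θ =>
    circleMap_mem_closedBall 0 zero_le_one θ
  have hnw : ∀ w ∈ closedBall (0 : ℂ) 1, 1 - z * w ≠ 0 := by
    intro w hw h
    have h1 : z * w = 1 := (sub_eq_zero.1 h).symm
    have : ‖z * w‖ < 1 := by
      rw [norm_mul]
      have := mem_closedBall_zero_iff.1 hw
      nlinarith [norm_nonneg z, norm_nonneg w]
    rw [h1, norm_one] at this
    exact lt_irrefl _ this
  set F : ℂ → ℂ := fun w => dslope χ 0 w * (w ^ 2 - 1) * z / (1 - z * w) with hF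
  have hFd : DifferentiableOn ℂ F (closedBall 0 1) := by
    have hds : DifferentiableOn ℂ (dslope χ 0) (closedBall 0 1) :=
      ((Complex.differentiableOn_dslope (ball_mem_nhds 0 (by linarith))).2 hχ).mono hsub
    exact ((hds.mul (by fun_prop)).mul_const z).div (by fun_prop) hnw
  have hC := hFd.circleIntegral_sub_inv_smul (mem_ball_zero_iff.2 hz)
  have hds : ∀ w, dslope χ 0 w * w = χ w := fun w => by
    have := sub_smul_dslope χ 0 w
    rw [h0, sub_zero, sub_zero, smul_eq_mul] at this
    rw [mul_comm]; exact this
  have hFz : F z = -χ z := by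
    have h1 := hnw z (mem_closedBall_zero_iff.2 hz.le)
    rw [hF]
    simp only
    rw [div_eq_iff h1, ← hds z]; ring
  have hw0 : ∀ θ : ℝ, circleMap 0 1 θ ≠ 0 := fun θ =>
    circleMap_ne_center one_ne_zero
  have hwz : ∀ θ : ℝ, circleMap 0 1 θ - z ≠ 0 := fun θ h => by
    rw [sub_eq_zero] at h
    rw [← h, norm_circleMap_zero, abs_one] at hz
    exact lt_irrefl _ hz
  have hw : ∀ θ : ℝ, circleMap 0 1 θ = Real.cos θ + Real.sin θ * I := fun θ => by
    simp [circleMap, exp_mul_I]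
  have hsq : ∀ θ : ℝ, (Real.sin θ : ℂ) ^ 2 + (Real.cos θ : ℂ) ^ 2 = 1 := fun θ => by
    exact_mod_cast Real.sin_sq_add_cos_sq θ
  have hw2 : ∀ θ : ℝ, circleMap 0 1 θ ^ 2 + 1 = 2 * Real.cos θ * circleMap 0 1 θ := fun θ => by
    rw [hw]; linear_combination (-1 : ℂ) * hsq θ + (Real.sin θ : ℂ) ^ 2 * I_sq
  have hw3 : ∀ θ : ℝ, circleMap 0 1 θ ^ 2 - 1 = 2 * I * Real.sin θ * circleMap 0 1 θ := fun θ => by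
    rw [hw]; linear_combination hsq θ - (Real.sin θ : ℂ) ^ 2 * I_sq
  have hden : ∀ θ : ℝ, (1 - z * circleMap 0 1 θ) * (circleMap 0 1 θ - z)
      = circleMap 0 1 θ * (1 - 2 * Real.cos θ * z + z ^ 2) := fun θ => by
    linear_combination (-z) * hw2 θ
  set k : ℝ → ℂ := fun θ => z / (1 - 2 * Real.cos θ * z + z ^ 2) with hk
  have hden0 : ∀ θ : ℝ, 1 - 2 * Real.cos θ * z + z ^ 2 ≠ 0 := fun θ h => by
    have := hden θ
    rw [h, mul_zero] at this
    exact mul_ne_zero (hnw _ (hcb θ)) (hwz θ) this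
  have hA : ∫ θ in (0 : ℝ)..2 * Real.pi, χ (circleMap 0 1 θ) * Real.sin θ * k θ
      = Real.pi * I * χ z := by
    rw [circleIntegral, hFz] at hC
    have : ∀ θ : ℝ, deriv (circleMap 0 1) θ • (circleMap 0 1 θ - z)⁻¹ • F (circleMap 0 1 θ)
        = -2 * (χ (circleMap 0 1 θ) * Real.sin θ * k θ) := fun θ => by
      have e : z / (1 - 2 * Real.cos θ * z + z ^ 2) = circleMap 0 1 θ * z /
          ((1 - z * circleMap 0 1 θ) * (circleMap 0 1 θ - z)) := by
        rw [hden, mul_div_mul_left _ _ (hw0 θ)]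
      have h1 := hnw _ (hcb θ)
      have h2 := hwz θ
      rw [deriv_circleMap, smul_eq_mul, smul_eq_mul, hF, hk]
      simp only
      rw [e, hw3, ← hds (circleMap 0 1 θ)]
      field_simp
      rw [I_sq]; ring
    simp only [this] at hC
    rw [intervalIntegral.integral_const_mul] at hC
    rw [smul_eq_mul] at hC
    linear_combination (-1 / 2 : ℂ) * hC
  have hcos : ∀ θ : ℝ, Real.cos (2 * Real.pi - θ) = Real.cos θ := Real.cos_two_pi_sub
  have hsin : ∀ θ : ℝ, Real.sin (2 * Real.pi - θ) = -Real.sin θ := Real.sin_two_pi_sub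
  have hB : ∫ θ in (0 : ℝ)..2 * Real.pi, conj (χ (circleMap 0 1 θ)) * Real.sin θ * k θ
      = -(Real.pi * I * χ z) := by
    rw [← hA, ← intervalIntegral.integral_neg]
    have := intervalIntegral.integral_comp_sub_left (a := 0) (b := 2 * Real.pi)
      (fun θ : ℝ => -(χ (circleMap 0 1 θ) * Real.sin θ * k θ)) (2 * Real.pi)
    rw [sub_self, sub_zero] at this
    rw [← this]
    refine intervalIntegral.integral_congr fun θ _ => ?_
    have hc : circleMap 0 1 (2 * Real.pi - θ) = conj (circleMap 0 1 θ) := by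
      rw [hw, hw, hcos, hsin]
      simp only [map_add, map_mul, conj_ofReal, conj_I, ofReal_neg]; ring
    simp only [hk]
    rw [hc, hconj _ (hsub (hcb θ)), hcos, hsin, ofReal_neg]; ring
  have hχc : Continuous fun θ : ℝ => χ (circleMap 0 1 θ) :=
    hχ.continuousOn.comp_continuous (continuous_circleMap 0 1) fun θ => hsub (hcb θ)
  have hkc : Continuous k := by
    rw [hk]
    exact continuous_const.div (by fun_prop) hden0
  have hs : Continuous fun θ : ℝ => (Real.sin θ : ℂ) := by fun_prop
  have hsum : ∫ θ in (0 : ℝ)..2 * Real.pi, (χ (circleMap 0 1 θ) * Real.sin θ * k θ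
      - conj (χ (circleMap 0 1 θ)) * Real.sin θ * k θ) = 2 * (Real.pi * I * χ z) := by
    rw [intervalIntegral.integral_sub, hA, hB]
    · ring
    · exact ((hχc.mul hs).mul hkc).intervalIntegrable _ _
    · exact (((continuous_conj.comp hχc).mul hs).mul hkc).intervalIntegrable _ _
  have hI : ∀ θ : ℝ, (χ (circleMap 0 1 θ) * Real.sin θ * k θ
      - conj (χ (circleMap 0 1 θ)) * Real.sin θ * k θ)
      = 2 * I * ((((χ (circleMap 0 1 θ)).im * Real.sin θ : ℝ) : ℂ) * k θ) := fun θ => by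
    rw [← sub_mul, ← sub_mul, sub_conj]
    push_cast; ring
  simp only [hI] at hsum
  rw [intervalIntegral.integral_const_mul] at hsum
  have h2I : (2 * I : ℂ) ≠ 0 := by simp
  refine mul_left_cancel₀ h2I ?_
  rw [hsum]; ring

theorem hasDerivAt_integral_kernel {w : ℝ → ℝ} (hw : Continuous w) {k k' : ℝ → ℂ → ℂ} {r : ℝ}
    (hk : ∀ t ∈ Icc (-1 : ℝ) 1, ∀ z ∈ ball (0 : ℂ) r, HasDerivAt (k t) (k' t z) z)
    (hkc : ∀ z ∈ ball (0 : ℂ) r, ContinuousOn (fun t => k t z) (Icc (-1 : ℝ) 1))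
    (hkc' : ContinuousOn (Function.uncurry k') (Icc (-1 : ℝ) 1 ×ˢ ball (0 : ℂ) r))
    {z : ℂ} (hz : z ∈ ball (0 : ℂ) r) :
    HasDerivAt (fun z => ∫ θ in (0 : ℝ)..2 * Real.pi, (w θ : ℂ) * k (Real.cos θ) z)
      (∫ θ in (0 : ℝ)..2 * Real.pi, (w θ : ℂ) * k' (Real.cos θ) z) z := by
  have hcos : ∀ θ : ℝ, Real.cos θ ∈ Icc (-1 : ℝ) 1 := Real.cos_mem_Icc
  have hwc : Continuous fun θ => (w θ : ℂ) := continuous_ofReal.comp hw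
  have hc1 : ∀ z ∈ ball (0 : ℂ) r, Continuous fun θ => (w θ : ℂ) * k (Real.cos θ) z :=
    fun z hz => hwc.mul ((hkc z hz).comp_continuous Real.continuous_cos hcos)
  have hc2 : Continuous fun θ => (w θ : ℂ) * k' (Real.cos θ) z :=
    hwc.mul (hkc'.comp_continuous (Real.continuous_cos.prodMk continuous_const)
      fun θ => ⟨hcos θ, hz⟩)
  obtain ⟨ε, hε, hsub⟩ := nhds_basis_closedBall.mem_iff.1 (isOpen_ball.mem_nhds hz)
  -- `k'` is bounded on the compact set `[-1, 1] × closedBall z ε`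
  obtain ⟨C, hC⟩ := (isCompact_Icc.prod (isCompact_closedBall z ε)).exists_bound_of_continuousOn
    (hkc'.mono (prod_mono_right hsub))
  refine (intervalIntegral.hasDerivAt_integral_of_dominated_loc_of_deriv_le
    (F' := fun z θ => (w θ : ℂ) * k' (Real.cos θ) z) (bound := fun θ => |w θ| * C)
    (closedBall_mem_nhds z hε) ?_ ?_ hc2.aestronglyMeasurable ?_ ?_ ?_).2
  · filter_upwards [isOpen_ball.mem_nhds hz] with z hz using (hc1 z hz).aestronglyMeasurable
  · exact (hc1 z hz).intervalIntegrable _ _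
  · refine Eventually.of_forall fun θ _ y hy => ?_
    rw [norm_mul, norm_real, Real.norm_eq_abs]
    exact mul_le_mul_of_nonneg_left (hC (Real.cos θ, y) ⟨hcos θ, hy⟩) (abs_nonneg _)
  · exact (hw.abs.mul continuous_const).intervalIntegrable _ _
  · exact Eventually.of_forall fun θ _ y hy => (hk _ (hcos θ) y (hsub hy)).const_mul _

theorem re_integral_weight_pos {w : ℝ → ℝ} (hw : Continuous w) (hw0 : ∀ θ, 0 ≤ w θ)
    {θ₀ : ℝ} (hθ₀ : θ₀ ∈ Icc 0 (2 * Real.pi)) (hpos : 0 < w θ₀) {k : ℝ → ℂ}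
    (hk : ContinuousOn k (Icc (-1) 1)) (hre : ∀ t ∈ Icc (-1 : ℝ) 1, 0 < (k t).re) :
    0 < (∫ θ in (0 : ℝ)..2 * Real.pi, (w θ : ℂ) * k (Real.cos θ)).re := by
  have hkc : Continuous fun θ => k (Real.cos θ) :=
    hk.comp_continuous Real.continuous_cos Real.cos_mem_Icc
  have hint : IntervalIntegrable (fun θ => (w θ : ℂ) * k (Real.cos θ)) volume 0 (2 * Real.pi) :=
    ((continuous_ofReal.comp hw).mul hkc).intervalIntegrable _ _
  rw [← reCLM_apply, ← ContinuousLinearMap.intervalIntegral_comp_comm reCLM hint]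
  simp only [reCLM_apply, re_ofReal_mul]
  exact intervalIntegral.integral_pos (by positivity)
    (hw.mul (continuous_re.comp hkc)).continuousOn
    (fun θ _ => mul_nonneg (hw0 θ) (hre _ (Real.cos_mem_Icc θ)).le)
    ⟨θ₀, hθ₀, mul_pos hpos (hre _ (Real.cos_mem_Icc θ₀))⟩

/-- The criterion `injOn_ball` for functions whose `H - G` is a positive superposition of kernels
`k t`: its hypotheses are checked on each kernel separately. Here `k₁ t` is the derivative of
`k t`, and `k₂ t` that of `z ↦ z * k₁ t z`. -/
theorem injOn_ball_of_kernel {H G : ℂ → ℂ} {r : ℝ} (hH : DifferentiableOn ℂ H (ball 0 r))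
    (hG : DifferentiableOn ℂ G (ball 0 r))
    (hlt : ∀ z ∈ ball (0 : ℂ) r, deriv (fun w => H w - G w) z ≠ 0 → ‖deriv G z‖ < ‖deriv H z‖)
    (hreal : ∀ x : ℝ, (x : ℂ) ∈ ball (0 : ℂ) r → (H x - G x).im = 0)
    {w : ℝ → ℝ} (hw : Continuous w) (hw0 : ∀ θ, 0 ≤ w θ) {θ₀ : ℝ}
    (hθ₀ : θ₀ ∈ Icc 0 (2 * Real.pi)) (hwpos : 0 < w θ₀) {k k₁ k₂ : ℝ → ℂ → ℂ} {C : ℂ}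
    (hrep : ∀ z ∈ ball (0 : ℂ) r,
      H z - G z = C + ∫ θ in (0 : ℝ)..2 * Real.pi, (w θ : ℂ) * k (Real.cos θ) z)
    (hk : ∀ t ∈ Icc (-1 : ℝ) 1, ∀ z ∈ ball (0 : ℂ) r, HasDerivAt (k t) (k₁ t z) z)
    (hk₁ : ∀ t ∈ Icc (-1 : ℝ) 1, ∀ z ∈ ball (0 : ℂ) r,
      HasDerivAt (fun z => z * k₁ t z) (k₂ t z) z)
    (hkc : ∀ z ∈ ball (0 : ℂ) r, ContinuousOn (fun t => k t z) (Icc (-1 : ℝ) 1))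
    (hkc₁ : ContinuousOn (Function.uncurry k₁) (Icc (-1 : ℝ) 1 ×ˢ ball (0 : ℂ) r))
    (hkc₂ : ContinuousOn (Function.uncurry k₂) (Icc (-1 : ℝ) 1 ×ˢ ball (0 : ℂ) r))
    (hpos : ∀ t ∈ Icc (-1 : ℝ) 1, ∀ z ∈ ball (0 : ℂ) r, 0 < (k₁ t z).re)
    (hcert : ∀ z ∈ ball (0 : ℂ) r, z.im ≠ 0 → ∃ l : ℝ, ∀ t ∈ Icc (-1 : ℝ) 1,
      l * (z * k₁ t z).re < z.im * (z * k₂ t z).im) :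
    InjOn (fun z => H z + conj (G z)) (ball (0 : ℂ) r) := by
  have hsec : ∀ {q : ℝ → ℂ → ℂ}, ContinuousOn (Function.uncurry q)
      (Icc (-1 : ℝ) 1 ×ˢ ball (0 : ℂ) r) → ∀ z ∈ ball (0 : ℂ) r,
      ContinuousOn (fun t => q t z) (Icc (-1 : ℝ) 1) := fun h z hz =>
    h.comp (continuousOn_id.prodMk continuousOn_const) fun t ht => ⟨ht, hz⟩
  have hd1 : ∀ z ∈ ball (0 : ℂ) r, deriv (fun w => H w - G w) z
      = ∫ θ in (0 : ℝ)..2 * Real.pi, (w θ : ℂ) * k₁ (Real.cos θ) z := by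
    intro z hz
    refine HasDerivAt.deriv (((hasDerivAt_integral_kernel hw hk hkc hkc₁ hz).const_add C
      ).congr_of_eventuallyEq ?_)
    filter_upwards [isOpen_ball.mem_nhds hz] with y hy using hrep y hy
  have hd2 : ∀ z ∈ ball (0 : ℂ) r, deriv (fun w => w * deriv (fun w => H w - G w) w) z
      = ∫ θ in (0 : ℝ)..2 * Real.pi, (w θ : ℂ) * k₂ (Real.cos θ) z := by
    intro z hz
    refine HasDerivAt.deriv ((hasDerivAt_integral_kernel (k := fun t z => z * k₁ t z) hw hk₁
      (fun z hz => continuousOn_const.mul (hsec hkc₁ z hz)) hkc₂ hz).congr_of_eventuallyEq ?_)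
    filter_upwards [isOpen_ball.mem_nhds hz] with y hy
    rw [hd1 y hy, ← intervalIntegral.integral_const_mul]
    refine intervalIntegral.integral_congr fun θ _ => ?_
    ring
  have hre : ∀ z ∈ ball (0 : ℂ) r, 0 < (deriv (fun w => H w - G w) z).re := fun z hz => by
    rw [hd1 z hz]
    exact re_integral_weight_pos hw hw0 hθ₀ hwpos (hsec hkc₁ z hz)
      fun t ht => hpos t ht z hz
  refine injOn_ball hH hG (fun z hz => hlt z hz fun h => ?_) hre hreal fun z hz hi h0 => ?_
  · have := hre z hz
    rw [h, zero_re] at this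
    exact lt_irrefl _ this
  · obtain ⟨l, hl⟩ := hcert z hz hi
    rw [hd1 z hz] at h0
    rw [hd2 z hz]
    -- the certificate turns the two integrals into one with a positive integrand
    have hcz : ContinuousOn (fun t => (z.im : ℂ) * -I * (z * k₂ t z) - l * (z * k₁ t z))
        (Icc (-1 : ℝ) 1) :=
      (continuousOn_const.mul (continuousOn_const.mul (hsec hkc₂ z hz))).sub
        (continuousOn_const.mul (continuousOn_const.mul (hsec hkc₁ z hz)))
    have key := re_integral_weight_pos hw hw0 hθ₀ hwpos hcz fun t ht => by
      have := hl t ht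
      rw [sub_re, mul_assoc, re_ofReal_mul, re_ofReal_mul]
      have e : (-I * (z * k₂ t z)).re = (z * k₂ t z).im := by
        simp only [neg_mul, neg_re, I_mul_re, neg_neg]
      rw [e]; linarith
    have hint : ∀ {q : ℝ → ℂ → ℂ}, ContinuousOn (Function.uncurry q)
        (Icc (-1 : ℝ) 1 ×ˢ ball (0 : ℂ) r) →
        IntervalIntegrable (fun θ => (w θ : ℂ) * q (Real.cos θ) z) volume 0 (2 * Real.pi) :=
      fun h => ((continuous_ofReal.comp hw).mul ((hsec h z hz).comp_continuous
        Real.continuous_cos Real.cos_mem_Icc)).intervalIntegrable _ _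
    have e : ∫ θ in (0 : ℝ)..2 * Real.pi, (w θ : ℂ) * ((z.im : ℂ) * -I *
          (z * k₂ (Real.cos θ) z) - l * (z * k₁ (Real.cos θ) z))
        = (z.im : ℂ) * (-I * (z * ∫ θ in (0 : ℝ)..2 * Real.pi, (w θ : ℂ) * k₂ (Real.cos θ) z))
          - l * (z * ∫ θ in (0 : ℝ)..2 * Real.pi, (w θ : ℂ) * k₁ (Real.cos θ) z) := by
      rw [← intervalIntegral.integral_const_mul, ← intervalIntegral.integral_const_mul,
        ← intervalIntegral.integral_const_mul, ← intervalIntegral.integral_const_mul,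
        ← intervalIntegral.integral_const_mul, ← intervalIntegral.integral_sub]
      · refine intervalIntegral.integral_congr fun θ _ => ?_
        ring
      · exact (((hint hkc₂).const_mul _).const_mul _).const_mul _
      · exact ((hint hkc₁).const_mul _).const_mul _
    rw [e, sub_re, re_ofReal_mul, re_ofReal_mul, h0, mul_zero, sub_zero] at key
    simpa only [neg_mul, neg_re, I_mul_re, neg_neg] using key

/-! ### Typically real harmonic functions -/

theorem map_conj_eq_conj_of_real_on_real {φ : ℂ → ℂ} (hφ : DifferentiableOn ℂ φ (ball 0 1))
    (hreal : ∀ x : ℝ, (x : ℂ) ∈ ball (0 : ℂ) 1 → (φ x).im = 0) {z : ℂ}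
    (hz : z ∈ ball (0 : ℂ) 1) : φ (conj z) = conj (φ z) := by
  have hconj : ∀ z ∈ ball (0 : ℂ) 1, conj z ∈ ball (0 : ℂ) 1 := fun z hz => by
    simpa using hz
  have hd : DifferentiableOn ℂ (conj ∘ φ ∘ conj) (ball 0 1) := fun z hz => by
    have := (hφ.differentiableAt (isOpen_ball.mem_nhds (hconj z hz))).conj_conj
    rw [conj_conj] at this
    exact this.differentiableWithinAt
  have hfreq : ∃ᶠ z in 𝓝[≠] (0 : ℂ), (conj ∘ φ ∘ conj) z = φ z := by
    have ht : Tendsto (fun x : ℝ => (x : ℂ)) (𝓝[≠] 0) (𝓝[≠] 0) := by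
      refine tendsto_nhdsWithin_iff.2 ⟨?_, ?_⟩
      · exact (continuous_ofReal.tendsto' 0 0 ofReal_zero).mono_left nhdsWithin_le_nhds
      · filter_upwards [self_mem_nhdsWithin] with x hx
        simpa using hx
    have hev : ∀ᶠ x : ℝ in 𝓝[≠] 0, (conj ∘ φ ∘ conj) (x : ℂ) = φ x := by
      have := (continuous_ofReal.tendsto' (0 : ℝ) (0 : ℂ) ofReal_zero).eventually
        (ball_mem_nhds 0 zero_lt_one)
      filter_upwards [mem_nhdsWithin_of_mem_nhds this] with x hx
      simp only [Function.comp_apply, conj_ofReal]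
      exact conj_eq_iff_im.2 (hreal x hx)
    exact ht.frequently hev.frequently
  have := (hd.analyticOnNhd isOpen_ball).eqOn_of_preconnected_of_frequently_eq
    (hφ.analyticOnNhd isOpen_ball) (convex_ball 0 1).isPreconnected
    (mem_ball_self zero_lt_one) hfreq hz
  rw [← this]
  simp

namespace TypicallyReal

variable {f h g : ℂ → ℂ}

theorem IsTypicallyRealHarmonic.im_eq (hf : IsTypicallyRealHarmonic f h g) {z : ℂ}
    (hz : z ∈ ball (0 : ℂ) 1) : (f z).im = (h z - g z).im := by
  rw [hf.eq_add_conj z hz, add_im, conj_im, sub_im, sub_eq_add_neg]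

/-- Where `h' ≠ g'`, the factor `1 - ω` and hence `h'` itself does not vanish. -/
theorem IsTypicallyRealHarmonic.norm_deriv_lt (hf : IsTypicallyRealHarmonic f h g) {z : ℂ}
    (hz : z ∈ ball (0 : ℂ) 1) (hne : deriv h z - deriv g z ≠ 0) : ‖deriv g z‖ < ‖deriv h z‖ := by
  obtain ⟨-, ω, -, hω, hlt⟩ := hf.sensePreserving z hz
  have h1 := hω.self_of_nhds
  have h0 : deriv h z ≠ 0 := fun h0 => hne (by rw [h1, h0]; simp)
  rw [h1, norm_mul]
  exact mul_lt_of_lt_one_left (norm_pos_iff.2 h0) hlt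

theorem IsTypicallyRealHarmonic.deriv_zero (hf : IsTypicallyRealHarmonic f h g)
    (hg0 : deriv g 0 = 0) : deriv h 0 = 1 := by
  have h0 : (0 : ℂ) ∈ ball (0 : ℂ) 1 := mem_ball_self zero_lt_one
  have hh : HasDerivAt h (deriv h 0) ((0 : ℝ) : ℂ) := by
    rw [ofReal_zero]; exact (hf.analytic_h 0 h0).differentiableAt.hasDerivAt
  have hg : HasDerivAt g 0 ((0 : ℝ) : ℂ) := by
    simpa [hg0] using (hf.analytic_g 0 h0).differentiableAt.hasDerivAt
  have hev : ∀ᶠ x : ℝ in 𝓝 0, (x : ℂ) ∈ ball (0 : ℂ) 1 :=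
    (continuous_ofReal.tendsto' (0 : ℝ) (0 : ℂ) ofReal_zero).eventually
      (ball_mem_nhds 0 zero_lt_one)
  have him : (deriv h 0).im = 0 := by
    have h1 := ((hh.sub hg).const_mul (-I)).real_of_complex
    have h2 : (fun x : ℝ => (-I * (h x - g x)).re) =ᶠ[𝓝 0] fun _ => 0 := by
      filter_upwards [hev] with x hx
      have := (hf.real_iff x hx).2 (ofReal_im x)
      rw [hf.im_eq hx] at this
      simpa using this
    have h3 := h2.deriv_eq
    rw [deriv_const] at h3
    have h4 := h1.deriv
    simp only [Pi.sub_apply] at h4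
    rw [h3] at h4
    simpa using h4.symm
  have hre : 0 ≤ (deriv h 0).re := by
    have h1 := (hh.add hg).real_of_complex
    rw [add_zero] at h1
    refine ge_of_tendsto ((hasDerivAt_iff_tendsto_slope.1 h1).mono_left (nhdsGT_le_nhdsNE 0)) ?_
    filter_upwards [Ioo_mem_nhdsGT (zero_lt_one' ℝ)] with x hx
    have hxb : (x : ℂ) ∈ ball (0 : ℂ) 1 := by
      rw [mem_ball_zero_iff, norm_real, Real.norm_eq_abs, abs_of_pos hx.1]; exact hx.2
    have hfre : ∀ z ∈ ball (0 : ℂ) 1, (h z + g z).re = (f z).re := fun z hz => by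
      rw [hf.eq_add_conj z hz, add_re, add_re, conj_re]
    have e1 := hfre x hxb
    have e0 := hfre 0 h0
    rw [hf.map_zero, zero_re] at e0
    rw [slope_def_field, sub_zero]
    simp only [Pi.add_apply, ofReal_zero]
    rw [e1, e0, sub_zero]
    exact div_nonneg (hf.pos x hx.1 hx.2).le hx.1.le
  have hreal : deriv h 0 = ((deriv h 0).re : ℂ) := Complex.ext rfl (by simpa using him)
  have hn := hf.norm_deriv_zero
  rw [hreal, norm_real, Real.norm_eq_abs, abs_of_nonneg hre] at hn
  rw [hreal, hn, ofReal_one]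

theorem IsTypicallyRealHarmonic.im_pos (hf : IsTypicallyRealHarmonic f h g)
    (hg0 : deriv g 0 = 0) {z : ℂ} (hz : z ∈ ball (0 : ℂ) 1) (hi : 0 < z.im) :
    0 < (h z - g z).im := by
  have h0 : (0 : ℂ) ∈ ball (0 : ℂ) 1 := mem_ball_self zero_lt_one
  have hne : ∀ z ∈ ball (0 : ℂ) 1, 0 < z.im → (h z - g z).im ≠ 0 := fun z hz hi h1 => by
    rw [← hf.im_eq hz, hf.real_iff z hz] at h1
    exact hi.ne' h1
  have hcont : ContinuousOn (fun z => (h z - g z).im) (ball (0 : ℂ) 1 ∩ {z | 0 < z.im}) :=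
    continuous_im.comp_continuousOn
      ((hf.analytic_h.continuousOn.sub hf.analytic_g.continuousOn).mono inter_subset_left)
  -- near the origin `h - g` behaves like the identity
  obtain ⟨w, hw, hwi, hwp⟩ : ∃ w ∈ ball (0 : ℂ) 1, 0 < w.im ∧ 0 < (h w - g w).im := by
    have hd : HasDerivAt (fun z => h z - g z) 1 (((0 : ℝ) : ℂ) * I) := by
      have := (hf.analytic_h 0 h0).differentiableAt.hasDerivAt.fun_sub
        (hf.analytic_g 0 h0).differentiableAt.hasDerivAt
      rw [hf.deriv_zero hg0, hg0, sub_zero] at this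
      simpa using this
    have hI : HasDerivAt (fun w : ℂ => w * I) I ((0 : ℝ) : ℂ) := by
      simpa using (hasDerivAt_id ((0 : ℝ) : ℂ)).mul_const I
    have h1 := ((hd.comp ((0 : ℝ) : ℂ) hI).const_mul (-I)).real_of_complex
    have h2 := (hasDerivAt_iff_tendsto_slope.1 h1).mono_left (nhdsGT_le_nhdsNE 0)
    have h3 : (0 : ℝ) < (-I * (1 * I)).re := by simp
    obtain ⟨y, hy, hy1⟩ := ((h2.eventually (lt_mem_nhds h3)).and
      (Ioo_mem_nhdsGT (zero_lt_one' ℝ))).exists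
    have hyb : (y * I : ℂ) ∈ ball (0 : ℂ) 1 := by
      rw [mem_ball_zero_iff, norm_mul, norm_I, mul_one, norm_real, Real.norm_eq_abs,
        abs_of_pos hy1.1]
      exact hy1.2
    refine ⟨y * I, hyb, by simpa using hy1.1, ?_⟩
    have e0 : (h 0 - g 0).im = 0 := by rw [← hf.im_eq h0, hf.map_zero, zero_im]
    rw [slope_def_field, sub_zero, lt_div_iff₀ hy1.1, zero_mul] at hy
    simp only [Function.comp_apply, neg_mul, neg_re, I_mul_re, neg_neg, ofReal_zero, zero_mul,
      e0, sub_zero] at hy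
    exact hy
  by_contra! hle
  have hpre : IsPreconnected (ball (0 : ℂ) 1 ∩ {z | 0 < z.im}) :=
    ((convex_ball 0 1).inter (convex_halfSpace_im_gt 0)).isPreconnected
  obtain ⟨v, ⟨hv, hvi⟩, hv0⟩ := hpre.intermediate_value ⟨hz, hi⟩ ⟨hw, hwi⟩ hcont ⟨hle, hwp.le⟩
  exact hne v hv hvi hv0

/-- Injectivity of `f` in a coordinate `ψ` on the disk `ball 0 r` in which the kernels
`z / (1 - 2 t z + z²)` become `m * k t`. The condition on `S` says that `S` lies in the image of `ψ`
after any dilation close enough to the identity. -/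
theorem IsTypicallyRealHarmonic.injOn_of_kernel (hf : IsTypicallyRealHarmonic f h g)
    (hg0 : deriv g 0 = 0) {r m : ℝ} (hm : 0 < m) {ψ : ℂ → ℂ}
    (hψ : DifferentiableOn ℂ ψ (ball 0 r)) (hmaps : MapsTo ψ (ball 0 r) (ball 0 1))
    (hψreal : ∀ x : ℝ, (x : ℂ) ∈ ball (0 : ℂ) r → (ψ x).im = 0)
    {k k₁ k₂ : ℝ → ℂ → ℂ}
    (hψk : ∀ t ∈ Icc (-1 : ℝ) 1, ∀ z ∈ ball (0 : ℂ) r,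
      ψ z / (1 - 2 * t * ψ z + ψ z ^ 2) = m * k t z)
    (hk : ∀ t ∈ Icc (-1 : ℝ) 1, ∀ z ∈ ball (0 : ℂ) r, HasDerivAt (k t) (k₁ t z) z)
    (hk₁ : ∀ t ∈ Icc (-1 : ℝ) 1, ∀ z ∈ ball (0 : ℂ) r,
      HasDerivAt (fun z => z * k₁ t z) (k₂ t z) z)
    (hkc : ∀ z ∈ ball (0 : ℂ) r, ContinuousOn (fun t => k t z) (Icc (-1 : ℝ) 1))
    (hkc₁ : ContinuousOn (Function.uncurry k₁) (Icc (-1 : ℝ) 1 ×ˢ ball (0 : ℂ) r))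
    (hkc₂ : ContinuousOn (Function.uncurry k₂) (Icc (-1 : ℝ) 1 ×ˢ ball (0 : ℂ) r))
    (hpos : ∀ t ∈ Icc (-1 : ℝ) 1, ∀ z ∈ ball (0 : ℂ) r, 0 < (k₁ t z).re)
    (hcert : ∀ z ∈ ball (0 : ℂ) r, z.im ≠ 0 → ∃ l : ℝ, ∀ t ∈ Icc (-1 : ℝ) 1,
      l * (z * k₁ t z).re < z.im * (z * k₂ t z).im)
    {S : Set ℂ} (hS : ∀ z ∈ S, ∀ᶠ σ : ℝ in 𝓝[<] 1, ∃ ζ ∈ ball (0 : ℂ) r, ψ ζ = z / σ) :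
    InjOn f S := by
  intro z₁ h₁ z₂ h₂ heq
  obtain ⟨σ, ⟨⟨ζ₁, hζ₁, e₁⟩, ⟨ζ₂, hζ₂, e₂⟩⟩, hσ⟩ := (((hS z₁ h₁).and (hS z₂ h₂)).and
    (Ioo_mem_nhdsLT (zero_lt_one' ℝ))).exists
  have hσ0 : (σ : ℂ) ≠ 0 := ofReal_ne_zero.2 hσ.1.ne'
  have hσψ : ∀ ζ ∈ ball (0 : ℂ) r, (σ : ℂ) * ψ ζ ∈ ball (0 : ℂ) 1 := fun ζ hζ => by
    have h1 := mem_ball_zero_iff.1 (hmaps hζ)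
    rw [mem_ball_zero_iff, norm_mul, norm_real, Real.norm_eq_abs, abs_of_pos hσ.1]
    nlinarith [hσ.1, hσ.2, norm_nonneg (ψ ζ)]
  set φ : ℂ → ℂ := fun z => h z - g z with hφ
  have hφd : DifferentiableOn ℂ φ (ball 0 1) :=
    hf.analytic_h.differentiableOn.sub hf.analytic_g.differentiableOn
  have hφreal : ∀ x : ℝ, (x : ℂ) ∈ ball (0 : ℂ) 1 → (φ x).im = 0 := fun x hx => by
    have := (hf.real_iff x hx).2 (ofReal_im x)
    rwa [hf.im_eq hx] at this
  have hφ0 : (φ 0).im = 0 := by simpa using hφreal 0 (by simp)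
  have hφconj : ∀ z ∈ ball (0 : ℂ) 1, φ (conj z) = conj (φ z) := fun z hz =>
    map_conj_eq_conj_of_real_on_real hφd hφreal hz
  have hball : ∀ z : ℂ, z ∈ ball (0 : ℂ) σ⁻¹ → (σ : ℂ) * z ∈ ball (0 : ℂ) 1 := fun z hz => by
    rw [mem_ball_zero_iff] at hz ⊢
    rw [norm_mul, norm_real, Real.norm_eq_abs, abs_of_pos hσ.1]
    exact (mul_lt_mul_of_pos_left hz hσ.1).trans_eq (mul_inv_cancel₀ hσ.1.ne')
  -- the dilated function `z ↦ φ (σ z) - φ 0` is analytic beyond the closed unit disk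
  have hχd : DifferentiableOn ℂ (fun z => φ (σ * z) - φ 0) (ball 0 σ⁻¹) :=
    (hφd.comp (by fun_prop) hball).sub_const _
  have hσinv : 1 < σ⁻¹ := (one_lt_inv₀ hσ.1).2 hσ.2
  have hcirc : ∀ θ : ℝ, circleMap 0 1 θ ∈ ball (0 : ℂ) σ⁻¹ := fun θ => by
    rw [mem_ball_zero_iff, norm_circleMap_zero, abs_one]; exact hσinv
  have hcirc_im : ∀ θ : ℝ, ((σ : ℂ) * circleMap 0 1 θ).im = σ * Real.sin θ := fun θ => by
    simp [circleMap, exp_ofReal_mul_I_im]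
  set w : ℝ → ℝ := fun θ =>
    m / Real.pi * ((φ (σ * circleMap 0 1 θ) - φ 0).im * Real.sin θ) with hw
  have hwc : Continuous w := by
    have : Continuous fun θ : ℝ => φ (σ * circleMap 0 1 θ) - φ 0 :=
      hχd.continuousOn.comp_continuous (continuous_circleMap 0 1) hcirc
    exact continuous_const.mul ((continuous_im.comp this).mul Real.continuous_sin)
  have hwpos : ∀ θ, 0 < Real.sin θ → 0 < w θ := fun θ hθ => by
    have h1 := hf.im_pos hg0 (hball _ (hcirc θ)) (by rw [hcirc_im]; exact mul_pos hσ.1 hθ)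
    rw [hw]
    simp only [sub_im, hφ0, sub_zero]
    exact mul_pos (div_pos hm Real.pi_pos) (mul_pos h1 hθ)
  have hwneg : ∀ θ, w (-θ) = w θ := fun θ => by
    have e : (σ : ℂ) * circleMap 0 1 (-θ) = conj (σ * circleMap 0 1 θ) := by
      rw [map_mul, conj_ofReal]
      congr 1
      simp [circleMap, ← exp_conj]
    rw [hw]
    simp only [sub_im, hφ0, sub_zero]
    rw [e, hφconj _ (hball _ (hcirc θ)), conj_im, Real.sin_neg]
    ring
  have hw0 : ∀ θ, 0 ≤ w θ := fun θ => by
    rcases lt_trichotomy (Real.sin θ) 0 with hs | hs | hs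
    · rw [← hwneg]; exact (hwpos _ (by rw [Real.sin_neg]; linarith)).le
    · rw [hw]; simp [hs]
    · exact (hwpos θ hs).le
  have hdiff : ∀ {F : ℂ → ℂ}, DifferentiableOn ℂ F (ball 0 1) → ∀ ζ ∈ ball (0 : ℂ) r,
      HasDerivAt (fun ζ => F (σ * ψ ζ)) (deriv F (σ * ψ ζ) * (σ * deriv ψ ζ)) ζ :=
    fun hF ζ hζ => (hF.differentiableAt
      (isOpen_ball.mem_nhds (hσψ ζ hζ))).hasDerivAt.comp ζ
      ((hψ.differentiableAt (isOpen_ball.mem_nhds hζ)).hasDerivAt.const_mul _)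
  have hh := fun ζ hζ => hdiff hf.analytic_h.differentiableOn ζ hζ
  have hg := fun ζ hζ => hdiff hf.analytic_g.differentiableOn ζ hζ
  have key := injOn_ball_of_kernel (H := fun ζ => h (σ * ψ ζ)) (G := fun ζ => g (σ * ψ ζ))
    (C := φ 0) (fun ζ hζ => (hh ζ hζ).differentiableAt.differentiableWithinAt)
    (fun ζ hζ => (hg ζ hζ).differentiableAt.differentiableWithinAt)
    (fun ζ hζ hne => ?_) (fun x hx => ?_) hwc hw0 (θ₀ := Real.pi / 2)
    ⟨by positivity, by linarith [Real.pi_pos]⟩ (hwpos _ (by rw [Real.sin_pi_div_two]; norm_num))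
    (fun ζ hζ => ?_) hk hk₁ hkc hkc₁ hkc₂ hpos hcert
  · have h3 := key hζ₁ hζ₂ (by
      simp only
      rw [← hf.eq_add_conj _ (hσψ ζ₁ hζ₁), ← hf.eq_add_conj _ (hσψ ζ₂ hζ₂), e₁, e₂,
        mul_div_cancel₀ _ hσ0, mul_div_cancel₀ _ hσ0, heq])
    rw [h3, e₂] at e₁
    exact ((div_left_inj' hσ0).1 e₁).symm
  · rw [((hh ζ hζ).fun_sub (hg ζ hζ)).deriv, ← sub_mul] at hne
    rw [(hh ζ hζ).deriv, (hg ζ hζ).deriv, norm_mul, norm_mul (deriv h _)]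
    exact mul_lt_mul_of_pos_right (hf.norm_deriv_lt (hσψ ζ hζ) (left_ne_zero_of_mul hne))
      (norm_pos_iff.2 (right_ne_zero_of_mul hne))
  · have e : (σ : ℂ) * ψ x = ((σ * (ψ x).re : ℝ) : ℂ) := by
      rw [ofReal_mul]
      congr 1
      exact Complex.ext rfl (by simpa using hψreal x hx)
    have := hσψ x hx
    rw [e] at this ⊢
    exact hφreal _ this
  · have hs := schwarz_integral_formula hσinv hχd (by simp) (fun z hz => by
      have e : (σ : ℂ) * conj z = conj (σ * z) := by rw [map_mul, conj_ofReal]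
      rw [e, hφconj _ (hball z hz), map_sub conj (φ _) (φ 0), conj_eq_iff_im.2 hφ0])
      (mem_ball_zero_iff.1 (hmaps hζ))
    have hπ : (Real.pi : ℂ) ≠ 0 := ofReal_ne_zero.2 Real.pi_ne_zero
    have e : ∀ θ : ℝ, (w θ : ℂ) * k (Real.cos θ) ζ = (Real.pi : ℂ)⁻¹ *
        ((((φ (σ * circleMap 0 1 θ) - φ 0).im * Real.sin θ : ℝ) : ℂ) *
          (ψ ζ / (1 - 2 * Real.cos θ * ψ ζ + ψ ζ ^ 2))) := fun θ => by
      rw [hψk _ (Real.cos_mem_Icc θ) ζ hζ, hw]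
      push_cast
      field_simp
    simp only [e]
    rw [intervalIntegral.integral_const_mul, hs, inv_mul_cancel_left₀ hπ, add_sub_cancel]

end TypicallyReal

/-! ### The two domains -/

/-- The zeros of the polynomial lie on the unit circle. -/
theorem koebe_denom_ne_zero {z : ℂ} (hz : ‖z‖ < 1) {t : ℝ} (ht : t ∈ Icc (-1 : ℝ) 1) :
    1 - 2 * t * z + z ^ 2 ≠ 0 := by
  intro h
  obtain ⟨e, he⟩ : ∃ e : ℂ, e = t + √(1 - t ^ 2) * I := ⟨_, rfl⟩
  have hsq : ((√(1 - t ^ 2) : ℝ) : ℂ) ^ 2 = 1 - t ^ 2 := by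
    have : (√(1 - t ^ 2)) ^ 2 = 1 - t ^ 2 := Real.sq_sqrt (by nlinarith [ht.1, ht.2])
    exact_mod_cast this
  have h1 : (z - e) * (z - conj e) = 0 := by
    rw [← h, he]
    simp only [map_add, map_mul, conj_ofReal, conj_I]
    linear_combination hsq - (√(1 - t ^ 2) : ℂ) ^ 2 * I_sq
  have hn : ‖e‖ = 1 := by
    have : ‖e‖ ^ 2 = 1 := by
      rw [he, ← normSq_eq_norm_sq, normSq_add_mul_I, Real.sq_sqrt (by nlinarith [ht.1, ht.2])]
      ring
    nlinarith [norm_nonneg e]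
  rcases mul_eq_zero.1 h1 with h2 | h2
  · rw [sub_eq_zero.1 h2, hn] at hz; exact lt_irrefl _ hz
  · rw [sub_eq_zero.1 h2, Complex.norm_conj, hn] at hz; exact lt_irrefl _ hz

theorem one_sub_mul_ne_zero {z : ℂ} (hz : ‖z‖ < 1) {t : ℝ} (ht : t ∈ Icc (-1 : ℝ) 1) :
    1 - (t : ℂ) * z ≠ 0 := by
  intro h
  have h1 : ‖(t : ℂ) * z‖ = 1 := by rw [← sub_eq_zero.1 h, norm_one]
  rw [norm_mul, norm_real, Real.norm_eq_abs] at h1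
  nlinarith [abs_le.2 ht, norm_nonneg z]

theorem eventually_norm_div_lt {z : ℂ} {r : ℝ} (hz : ‖z‖ < r) :
    ∀ᶠ σ : ℝ in 𝓝[<] 1, ‖z / σ‖ < r := by
  have h : Tendsto (fun σ : ℝ => ‖z / σ‖) (𝓝 1) (𝓝 ‖z / (1 : ℝ)‖) :=
    (continuousAt_const.div continuous_ofReal.continuousAt (by simp)).norm
  rw [ofReal_one, div_one] at h
  exact nhdsWithin_le_nhds (h.eventually (gt_mem_nhds hz))

theorem one_add_sq_ne_zero {z : ℂ} (hz : ‖z‖ < 1) : 1 + z ^ 2 ≠ 0 := by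
  have := koebe_denom_ne_zero hz (t := 0) (by norm_num)
  simpa using this

/-- The inverse `ζ ↦ ζ / (1 + √(1 - ζ²))` of the map `z ↦ 2 z / (1 + z²)` of the unit disk. -/
noncomputable def slitInverse (ζ : ℂ) : ℂ := ζ / (1 + Complex.sqrt (1 - ζ ^ 2))

theorem re_one_sub_sq_pos {ζ : ℂ} (hζ : ‖ζ‖ < 1) : 0 < (1 - ζ ^ 2).re := by
  have h := (abs_le.1 (abs_re_le_norm (ζ ^ 2))).2
  rw [norm_pow] at h
  rw [sub_re, one_re]
  nlinarith [norm_nonneg ζ]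

theorem re_sqrt_one_sub_sq_pos {ζ : ℂ} (hζ : ‖ζ‖ < 1) : 0 < (Complex.sqrt (1 - ζ ^ 2)).re := by
  have := re_one_sub_sq_pos hζ
  rw [Complex.sqrt, cpow_inv_two_re]
  positivity

theorem slitInverse_norm_lt {ζ : ℂ} (hζ : ‖ζ‖ < 1) : ‖slitInverse ζ‖ < 1 := by
  obtain ⟨s, hs⟩ : ∃ s, s = Complex.sqrt (1 - ζ ^ 2) := ⟨_, rfl⟩
  have hre : 0 < s.re := hs ▸ re_sqrt_one_sub_sq_pos hζ
  rw [slitInverse, ← hs]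
  have h1 : 1 < ‖1 + s‖ := by
    have := re_le_norm (1 + s)
    rw [add_re, one_re] at this
    linarith
  rw [norm_div, div_lt_one (by linarith)]
  linarith

theorem slitInverse_relation {ζ : ℂ} (hζ : ‖ζ‖ < 1) :
    2 * slitInverse ζ = ζ * (1 + slitInverse ζ ^ 2) := by
  obtain ⟨s, hs⟩ : ∃ s, s = Complex.sqrt (1 - ζ ^ 2) := ⟨_, rfl⟩
  have hre : 0 < s.re := hs ▸ re_sqrt_one_sub_sq_pos hζ
  have hsq : s ^ 2 = 1 - ζ ^ 2 := by
    rw [hs, Complex.sqrt]; simp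
  have h1 : 1 + s ≠ 0 := fun h => by
    have := congrArg Complex.re h
    rw [add_re, one_re, zero_re] at this
    linarith
  rw [slitInverse, ← hs]
  field_simp
  linear_combination -ζ * hsq

theorem slitInverse_apply {z : ℂ} (hz : ‖z‖ < 1) : slitInverse (2 * z / (1 + z ^ 2)) = z := by
  have h0 := one_add_sq_ne_zero hz
  have hre : 0 < ((1 - z ^ 2) / (1 + z ^ 2)).re := by
    have : ‖-z ^ 2‖ < ‖(1 : ℂ)‖ := by
      rw [norm_neg, norm_pow, norm_one]
      exact pow_lt_one₀ (norm_nonneg z) hz two_ne_zero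
    simpa [sub_eq_add_neg] using re_div_sub_pos this
  have hs : Complex.sqrt (1 - (2 * z / (1 + z ^ 2)) ^ 2) = (1 - z ^ 2) / (1 + z ^ 2) := by
    have e : 1 - (2 * z / (1 + z ^ 2)) ^ 2 = ((1 - z ^ 2) / (1 + z ^ 2)) ^ 2 := by
      field_simp; ring
    rw [e, Complex.sqrt, sq_cpow_two_inv hre]
  rw [slitInverse, hs]
  field_simp
  ring

theorem differentiableOn_slitInverse : DifferentiableOn ℂ slitInverse (ball 0 1) := by
  intro ζ hζ
  have hζ' := mem_ball_zero_iff.1 hζ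
  have hre := re_sqrt_one_sub_sq_pos hζ'
  have h1 : 1 + Complex.sqrt (1 - ζ ^ 2) ≠ 0 := fun h => by
    have := congrArg Complex.re h
    rw [add_re, one_re, zero_re] at this
    linarith
  refine DifferentiableAt.differentiableWithinAt ?_
  refine differentiableAt_id.div ?_ h1
  refine (differentiableAt_const _).add ?_
  exact DifferentiableAt.comp (f := fun ζ => 1 - ζ ^ 2) ζ
    (differentiableAt_sqrt (mem_slitPlane_iff.2 (Or.inl (re_one_sub_sq_pos hζ')))) (by fun_prop)

theorem slitInverse_ofReal_im {x : ℝ} (hx : ‖(x : ℂ)‖ < 1) : (slitInverse x).im = 0 := by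
  rw [norm_real, Real.norm_eq_abs] at hx
  have : (0 : ℝ) ≤ 1 - x ^ 2 := by nlinarith [abs_lt.1 hx]
  have e : slitInverse x = ((x / (1 + (1 - x ^ 2) ^ (2⁻¹ : ℝ)) : ℝ) : ℂ) := by
    rw [slitInverse, Complex.sqrt]
    push_cast [ofReal_cpow this]
    rfl
  rw [e, ofReal_im]

theorem theorem6 (f : ℂ → ℂ) (hf : f ∈ TypicallyReal.classTHO) :
    Set.InjOn f (Metric.ball (0 : ℂ) (Real.sqrt 6 - Real.sqrt 5)) ∧
      Set.InjOn f {z : ℂ | z ∈ Metric.ball (0 : ℂ) 1 ∧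
        ‖2 * z / (1 + z ^ 2)‖ < Real.sqrt 2 - 1} := by
  obtain ⟨h, g, hf, hg0⟩ := hf
  constructor
  · have hr : √6 - √5 < 1 := by
      have h5 : 2 < √5 := by rw [Real.lt_sqrt] <;> norm_num
      have h6 : √6 < 3 := by rw [Real.sqrt_lt'] <;> norm_num
      linarith
    have hsub : ball (0 : ℂ) (√6 - √5) ⊆ ball 0 1 := ball_subset_ball hr.le
    have hne : ∀ t ∈ Icc (-1 : ℝ) 1, ∀ z ∈ ball (0 : ℂ) (√6 - √5),
        1 - 2 * t * z + z ^ 2 ≠ 0 := fun t ht z hz =>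
      koebe_denom_ne_zero (mem_ball_zero_iff.1 (hsub hz)) ht
    have hd : ∀ (t : ℝ) (z : ℂ), HasDerivAt (fun z : ℂ => 1 - 2 * t * z + z ^ 2)
        (-2 * t + 2 * z) z := fun t z => by
      have := (((hasDerivAt_id z).const_mul (2 * t : ℂ)).const_sub 1).fun_add
        ((hasDerivAt_id z).fun_pow 2)
      simpa using this
    refine hf.injOn_of_kernel hg0 one_pos differentiableOn_id hsub (fun x _ => by simp)
      (k := fun t z => z / (1 - 2 * t * z + z ^ 2))
      (k₁ := fun t z => (1 - z ^ 2) / (1 - 2 * t * z + z ^ 2) ^ 2)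
      (k₂ := fun t z => (z ^ 4 - 6 * z ^ 2 + 1 + 2 * t * z + 2 * t * z ^ 3) /
        (1 - 2 * t * z + z ^ 2) ^ 3) (fun t _ z _ => by simp) (fun t ht z hz => ?_)
      (fun t ht z hz => ?_) (fun z hz => ?_) ?_ ?_
      (fun t ht z hz => koebe_re_deriv_pos (mem_ball_zero_iff.1 hz) ht)
      (fun z hz hi => exists_koebe_certificate (mem_ball_zero_iff.1 hz) hi) (fun z hz => ?_)
    · refine ((hasDerivAt_id z).div (hd t z) (hne t ht z hz)).congr_deriv ?_
      simp only [id_eq]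
      congr 1; ring
    · have h1 := hne t ht z hz
      have h2 := (hasDerivAt_id z).mul ((((hasDerivAt_id z).pow 2).const_sub 1).div
        ((hd t z).pow 2) (pow_ne_zero 2 h1))
      refine h2.congr_deriv ?_
      simp only [id_eq, Pi.pow_apply, Pi.div_apply]
      obtain ⟨d, hdz⟩ : ∃ d, d = 1 - 2 * t * z + z ^ 2 := ⟨_, rfl⟩
      rw [← hdz] at h1 ⊢
      field_simp
      rw [hdz]
      ring
    · exact ContinuousOn.div (by fun_prop) (by fun_prop) fun t ht => hne t ht z hz
    · exact ContinuousOn.div (by fun_prop) (by fun_prop) fun p hp =>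
        pow_ne_zero 2 (hne p.1 hp.1 p.2 hp.2)
    · exact ContinuousOn.div (by fun_prop) (by fun_prop) fun p hp =>
        pow_ne_zero 3 (hne p.1 hp.1 p.2 hp.2)
    · filter_upwards [eventually_norm_div_lt (mem_ball_zero_iff.1 hz)] with σ hσ
      exact ⟨_, mem_ball_zero_iff.2 hσ, rfl⟩
  · have hr : √2 - 1 < 1 := by
      have h2 : √2 < 2 := by rw [Real.sqrt_lt'] <;> norm_num
      linarith
    have hsub : ball (0 : ℂ) (√2 - 1) ⊆ ball 0 1 := ball_subset_ball hr.le
    have hlt : ∀ z ∈ ball (0 : ℂ) (√2 - 1), ‖z‖ < 1 := fun z hz => mem_ball_zero_iff.1 (hsub hz)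
    have hne : ∀ t ∈ Icc (-1 : ℝ) 1, ∀ z ∈ ball (0 : ℂ) (√2 - 1), 1 - t * z ≠ 0 :=
      fun t ht z hz => one_sub_mul_ne_zero (hlt z hz) ht
    have hd : ∀ (t : ℝ) (z : ℂ), HasDerivAt (fun z : ℂ => 1 - t * z) (-t) z := fun t z => by
      simpa using ((hasDerivAt_id z).const_mul (t : ℂ)).const_sub 1
    refine hf.injOn_of_kernel hg0 (m := 1 / 2) one_half_pos
      (differentiableOn_slitInverse.mono hsub)
      (fun z hz => mem_ball_zero_iff.2 (slitInverse_norm_lt (hlt z hz)))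
      (fun x hx => slitInverse_ofReal_im (hlt x hx))
      (k := fun t z => z / (1 - t * z))
      (k₁ := fun t z => 1 / (1 - t * z) ^ 2)
      (k₂ := fun t z => (1 + t * z) / (1 - t * z) ^ 3) (fun t ht z hz => ?_)
      (fun t ht z hz => ?_) (fun t ht z hz => ?_) (fun z hz => ?_) ?_ ?_
      (fun t ht z hz => cauchy_re_deriv_pos (mem_ball_zero_iff.1 hz) ht)
      (fun z hz hi => exists_cauchy_certificate (mem_ball_zero_iff.1 hz) hi) (fun z hz => ?_)
    · have h1 := koebe_denom_ne_zero (slitInverse_norm_lt (hlt z hz)) ht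
      have h2 := hne t ht z hz
      have h3 := slitInverse_relation (hlt z hz)
      push_cast
      rw [← mul_div_assoc, div_eq_div_iff h1 h2]
      linear_combination (1 / 2 : ℂ) * h3
    · refine ((hasDerivAt_id z).div (hd t z) (hne t ht z hz)).congr_deriv ?_
      simp only [id_eq]
      congr 1; ring
    · have h1 := hne t ht z hz
      have h2 := (hasDerivAt_id z).mul ((hasDerivAt_const z (1 : ℂ)).div
        ((hd t z).pow 2) (pow_ne_zero 2 h1))
      refine h2.congr_deriv ?_
      simp only [id_eq, Pi.pow_apply, Pi.div_apply]
      field_simp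
      ring
    · exact ContinuousOn.div (by fun_prop) (by fun_prop) fun t ht => hne t ht z hz
    · exact ContinuousOn.div (by fun_prop) (by fun_prop) fun p hp =>
        pow_ne_zero 2 (hne p.1 hp.1 p.2 hp.2)
    · exact ContinuousOn.div (by fun_prop) (by fun_prop) fun p hp =>
        pow_ne_zero 3 (hne p.1 hp.1 p.2 hp.2)
    · obtain ⟨hz1, hz2⟩ := hz
      rw [mem_ball_zero_iff] at hz1
      have hcont : Tendsto (fun σ : ℝ => ‖2 * (z / σ) / (1 + (z / σ) ^ 2)‖) (𝓝 1)
          (𝓝 ‖2 * (z / (1 : ℝ)) / (1 + (z / (1 : ℝ)) ^ 2)‖) := by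
        have hq : ContinuousAt (fun σ : ℝ => z / (σ : ℂ)) 1 :=
          continuousAt_const.div continuous_ofReal.continuousAt (by simp)
        refine ((continuousAt_const.mul hq).div (continuousAt_const.add (hq.pow 2)) ?_).norm
        simpa using one_add_sq_ne_zero hz1
      rw [ofReal_one, div_one] at hcont
      filter_upwards [eventually_norm_div_lt hz1,
        nhdsWithin_le_nhds (hcont.eventually (gt_mem_nhds hz2))] with σ h1 h2
      exact ⟨_, mem_ball_zero_iff.2 h2, slitInverse_apply h1⟩
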